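/- **Theorem 3.4.** Let $n,m\ge 1$, let $1<p_1,\dots,p_m<\infty$, write $\vec P=(p_1,\dots,p_m)$, $p_i'=p_i/(p_i-1)$, and let $p$ be given by $\frac1p=\frac1{p_1}+\dots+\frac1{p_m}$. Cubes are cubes in $\mathbb R^n$ with sides parallel to the axes, and $\chi_Q$ is the indicator function of $Q$. For $\vec g=(g_1,\dots,g_m)$ and for a single function $g$ put $$\mathcal M(\vec g)(x)=\sup_{Q\ni x}\prod_{i=1}^m\frac1{|Q|}\int_Q|g_i(y)|\,dy,\qquad Mg(x)=\sup_{Q\ni x}\frac1{|Q|}\int_Q|g(y)|\,dy,$$ the suprema being over all cubes $Q$ containing $x$. There is a constant $C=C(n,m,\vec P)<\infty$ such that the following holds. Let $v,w_1,\dots,w_m$ be weights on $\mathbb R^n$ (measurable real functions, $v\ge0$ and $w_i>0$ almost everywhere; local integrability is not needed), let $\sigma_i=w_i^{1-p_i'}$, $\vec w=(w_1,\dots,w_m)$, $\vec\sigma=(\sigma_1,\dots,\sigma_m)$, and let $$[v,\vec w]_{A_{\vec P}}=\sup_Q\Big(\frac1{|Q|}\int_Q v\Big)\prod_{i=1}^m\Big(\frac1{|Q|}\int_Q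 w_i^{1-p_i'}\Big)^{p/p_i'},\qquad [\vec\sigma]_{W^\infty_{\vec P}}=\sup_Q\frac{\int_Q\prod_{i=1}^m M(\sigma_i\chi_Q)^{p/p_i}\,dx}{\int_Q\prod_{i=1}^m\sigma_i^{p/p_i}\,dx}.$$ Then for all complex-valued $f_i\in L^{p_i}(\sigma_i)$, $i=1,\dots,m$, $$\|\mathcal M(f_1\sigma_1,\dots,f_m\sigma_m)\|_{L^p(v)}\le C\,\big([v,\vec w]_{A_{\vec P}}\,[\vec\sigma]_{W^\infty_{\vec P}}\big)^{1/p}\prod_{i=1}^m\|f_i\|_{L^{p_i}(\sigma_i)}.$$ Here $\|g\|_{L^q(u)}=\big(\int_{\mathbb R^n}|g|^q u\,dx\big)^{1/q}$, also when $q<1$. All quantities take values in $[0,\infty]$, with $0\cdot\infty=0$, and the quotient in $[\vec\sigma]_{W^\infty_{\vec P}}$ is read as $\infty$ if its denominator is infinite (which cannot happen when the $\sigma_i$ are locally integrable). -/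

import Mathlib

open MeasureTheory
open scoped ENNReal NNReal

noncomputable section

namespace MultiWeight

variable {n m : ℕ}

/-- A cube in `ℝⁿ` with sides parallel to the axes, in the half-open form `∏ [a j, a j + ℓ)`.
Only averages over cubes enter below, and the maximal functions are the same for open, closed or
half-open cubes. -/
def IsCube (Q : Set (Fin n → ℝ)) : Prop :=
  ∃ (a : Fin n → ℝ) (ℓ : ℝ), 0 < ℓ ∧ Q = Set.univ.pi fun j => Set.Ico (a j) (a j + ℓ)

/-- A weight: a measurable function which is nonnegative almost everywhere. Local integrability
is not required, so in particular every locally integrable weight is covered. -/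
def IsWeight (w : (Fin n → ℝ) → ℝ) : Prop :=
  AEMeasurable w ∧ ∀ᵐ x, 0 ≤ w x

/-- The measure `w(x) dx`. -/
def wMeasure (w : (Fin n → ℝ) → ℝ) : Measure (Fin n → ℝ) :=
  volume.withDensity fun x => ENNReal.ofReal (w x)

/-- The (uncentred) Hardy-Littlewood maximal function
`M f (x) = sup_{Q ∋ x} |Q|⁻¹ ∫_Q |f|`. -/
def maximal (f : (Fin n → ℝ) → ℝ) (x : Fin n → ℝ) : ℝ≥0∞ :=
  ⨆ (Q : Set (Fin n → ℝ)) (_ : IsCube Q) (_ : x ∈ Q), ⨍⁻ y in Q, ‖f y‖ₑ ∂volume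

/-- The multisublinear maximal function
`𝓜(f₁, …, f_m)(x) = sup_{Q ∋ x} ∏ i, |Q|⁻¹ ∫_Q |f_i|`. -/
def multiMaximal (f : Fin m → (Fin n → ℝ) → ℂ) (x : Fin n → ℝ) : ℝ≥0∞ :=
  ⨆ (Q : Set (Fin n → ℝ)) (_ : IsCube Q) (_ : x ∈ Q), ∏ i, ⨍⁻ y in Q, ‖f i y‖ₑ ∂volume

/-- The dual weight `w ^ (1 - q')`, where `q' = q / (q - 1)`. -/
def dualWeight (q : ℝ) (w : (Fin n → ℝ) → ℝ) (x : Fin n → ℝ) : ℝ :=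
  w x ^ (1 - q.conjExponent)

/-- The two-weight constant
`[v, w]_{A_P} = sup_Q (|Q|⁻¹ ∫_Q v) ∏ i, (|Q|⁻¹ ∫_Q w_i ^ (1 - p_i')) ^ (p / p_i')`. -/
def apConst (p : ℝ) (P : Fin m → ℝ) (v : (Fin n → ℝ) → ℝ) (w : Fin m → (Fin n → ℝ) → ℝ) :
    ℝ≥0∞ :=
  ⨆ (Q : Set (Fin n → ℝ)) (_ : IsCube Q),
    (⨍⁻ x in Q, ENNReal.ofReal (v x) ∂volume) *
      ∏ i, (⨍⁻ x in Q, ENNReal.ofReal (dualWeight (P i) (w i) x) ∂volume) ^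
          (p / (P i).conjExponent)

open Classical in
/-- The quotient `a / b` of extended nonnegative numbers, with the value `∞` when `b = ∞`
(Mathlib's `a / ∞` is `0`, even for `a = ∞`). -/
def ratio (a b : ℝ≥0∞) : ℝ≥0∞ :=
  if b = ∞ then ∞ else a / b

/-- The multilinear Fujii-Wilson constant
`[w]_{W_P^∞} = sup_Q (∫_Q ∏ i, M(w_i χ_Q) ^ (p / p_i)) / (∫_Q ∏ i, w_i ^ (p / p_i))`.
For `1/p = ∑ 1/p_i` and locally integrable `w_i` the denominators are finite by Hölder's
inequality, so that the convention in `ratio` plays no role; if a denominator is infinite, the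
constant is `∞`. -/
def wInftyConst (p : ℝ) (P : Fin m → ℝ) (w : Fin m → (Fin n → ℝ) → ℝ) : ℝ≥0∞ :=
  ⨆ (Q : Set (Fin n → ℝ)) (_ : IsCube Q),
    ratio (∫⁻ x in Q, ∏ i, maximal (Q.indicator (w i)) x ^ (p / P i))
      (∫⁻ x in Q, ∏ i, ENNReal.ofReal (w i x) ^ (p / P i))

end MultiWeight

end

/-! Every cube lies in a cube of comparable size from one of `2 ^ n` shifted dyadic grids, so
`multiMaximal` is dominated by finitely many dyadic maximal functions. Cubes of one grid are nested
or disjoint (`Laminar`), and by monotone convergence finite subfamilies suffice.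

Let `l Q` be the product of the averages of `|f_i| σ_i` over `Q`. A stopping-time selection keeps
principal cubes, along which `l` increases by more than the factor `a = (2m)^m`; the `p`-th power of
the maximal function is then at most `a ^ p` times the sum of `l R ^ p` over the principal `R`
containing the point. When the product increases this much, some factor increases by more than `2m`,
so the principal cubes strictly inside `R` fill at most half of `R`.

The average of `|f_i| σ_i` over `R` is the `σ_i`-average `e_i(R)` of `|f_i|` times the average of
`σ_i`. As `p = p/p_i' + p/p_i`, the `A_P` constant bounds `l R ^ p ∫_R v` by `A |R| w(R) ∏ e_i(R) ^
p`, where `w(R)` is the product of the averages of `σ_i` to the powers `p/p_i`. Sparseness and the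
Fujii-Wilson constant `K` show that `|R| w(R)` is a Carleson sequence for `ν = ∏ σ_i ^ (p/p_i) dx`,
with constant `2K`. Carleson embedding leaves `∫ sup_R ∏ e_i(R) ^ p dν`. Hölder's inequality reduces
this to the dyadic maximal functions with respect to `σ_i`, whose bounds on `L^{p_i}(σ_i)` do not
depend on `σ_i`. -/

noncomputable section

namespace MultiWeight

/-! ### Laminar families: selection, Carleson embedding, maximal inequalities -/

section Laminar

variable {X : Type*}

/-- A family of sets any two of which are nested or disjoint. -/
def Laminar (T : Set (Set X)) : Prop :=
  ∀ Q ∈ T, ∀ R ∈ T, Q ⊆ R ∨ R ⊆ Q ∨ Disjoint Q R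

theorem Laminar.mono {S T : Set (Set X)} (hT : Laminar T) (h : S ⊆ T) : Laminar S :=
  fun Q hQ R hR => hT Q (h hQ) R (h hR)

/-- The pointwise supremum of the values `c Q` over the members `Q` of the family that contain
the given point. -/
def familySup (T : Set (Set X)) (c : Set X → ℝ≥0∞) (x : X) : ℝ≥0∞ :=
  ⨆ Q ∈ T, Q.indicator (fun _ => c Q) x

theorem le_familySup {T : Set (Set X)} {c : Set X → ℝ≥0∞} {x : X} {Q : Set X} (hQ : Q ∈ T)
    (hx : x ∈ Q) : c Q ≤ familySup T c x := by
  refine le_trans ?_ (le_iSup₂ (f := fun Q (_ : Q ∈ T) => Q.indicator (fun _ => c Q) x) Q hQ)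
  simp [hx]

theorem familySup_le {T : Set (Set X)} {c : Set X → ℝ≥0∞} {x : X} {b : ℝ≥0∞}
    (h : ∀ Q ∈ T, x ∈ Q → c Q ≤ b) : familySup T c x ≤ b := by
  refine iSup₂_le fun Q hQ => ?_
  by_cases hx : x ∈ Q
  · simpa [hx] using h Q hQ hx
  · simp [hx]

theorem measurable_familySup [MeasurableSpace X] {T : Set (Set X)} (hT : T.Countable)
    (hm : ∀ Q ∈ T, MeasurableSet Q) (c : Set X → ℝ≥0∞) : Measurable (familySup T c) :=
  Measurable.biSup T hT fun Q hQ => measurable_const.indicator (hm Q hQ)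

/-- The maximal members do this: distinct ones cannot be nested, hence are disjoint, and finiteness
puts every member below one of them. -/
theorem exists_pairwiseDisjoint_cover (T : Finset (Set X)) (hT : Laminar (T : Set (Set X))) :
    ∃ U ⊆ T, (U : Set (Set X)).PairwiseDisjoint id ∧ ∀ Q ∈ T, ∃ R ∈ U, Q ⊆ R := by
  classical
  refine ⟨T.filter fun Q => Maximal (fun R => R ∈ T) Q, Finset.filter_subset _ _, ?_, ?_⟩
  · intro Q hQ R hR hne
    simp only [Finset.coe_filter, Set.mem_ofPred_eq] at hQ hR
    rcases hT Q hQ.1 R hR.1 with h | h | h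
    · exact absurd (hQ.2.eq_of_le hR.1 h) hne
    · exact absurd (hR.2.eq_of_le hQ.1 h).symm hne
    · exact h
  · intro Q hQ
    obtain ⟨R, hQR, hR⟩ := T.exists_le_maximal hQ
    exact ⟨R, by simp [hR.prop, hR], hQR⟩

/-- A stopping-time selection: every member of `T` lies in a selected one with comparable value,
and the values of the selected sets increase by the factor `a` under strict inclusion. -/
theorem exists_principal_subfamily (T : Finset (Set X)) (c : Set X → ℝ≥0∞) {a : ℝ≥0∞}
    (ha : 1 ≤ a) :
    ∃ S ⊆ T, (∀ Q ∈ T, ∃ R ∈ S, Q ⊆ R ∧ c Q ≤ a * c R) ∧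
      ∀ Q ∈ S, ∀ R ∈ S, Q ⊂ R → a * c R < c Q := by
  classical
  induction T using Finset.strongInduction with
  | H T ih =>
    rcases T.eq_empty_or_nonempty with rfl | hne
    · exact ⟨∅, by simp⟩
    -- Minimality ensures that, if `Q` has to be added after the selection from the rest, no set
    -- already selected lies strictly inside it.
    obtain ⟨Q, hQ⟩ := Finset.exists_minimal hne
    obtain ⟨S, hST, hcov, hinc⟩ := ih _ (Finset.erase_ssubset hQ.prop)
    by_cases h : ∃ R ∈ S, Q ⊆ R ∧ c Q ≤ a * c R
    · refine ⟨S, hST.trans (Finset.erase_subset _ _), fun R hR => ?_, hinc⟩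
      by_cases hRQ : R = Q
      · exact hRQ ▸ h
      · exact hcov R (Finset.mem_erase.2 ⟨hRQ, hR⟩)
    · push Not at h
      refine ⟨insert Q S, ?_, fun R hR => ?_, ?_⟩
      · exact Finset.insert_subset hQ.prop (hST.trans (Finset.erase_subset _ _))
      · by_cases hRQ : R = Q
        · subst hRQ
          exact ⟨R, by simp, subset_rfl, le_mul_of_one_le_left' ha⟩
        · obtain ⟨R', hR', h'⟩ := hcov R (Finset.mem_erase.2 ⟨hRQ, hR⟩)
          exact ⟨R', by simp [hR'], h'⟩
      · intro R hR R' hR' hRR'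
        rw [Finset.mem_insert] at hR hR'
        rcases hR with rfl | hR
        · rcases hR' with rfl | hR'
          · exact absurd hRR' (ssubset_irrefl _)
          · exact h R' hR' hRR'.subset
        · rcases hR' with rfl | hR'
          · exact absurd (hQ.eq_of_ge (Finset.mem_of_mem_erase (hST hR)) hRR'.subset)
              hRR'.ne'
          · exact hinc R hR R' hR' hRR'

variable [MeasurableSpace X]

theorem mul_measure_biUnion_le {T : Finset (Set X)} (hT : Laminar (T : Set (Set X)))
    (hm : ∀ Q ∈ T, MeasurableSet Q) (μ ν : Measure X) {t : ℝ≥0∞}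
    (h : ∀ Q ∈ T, t * μ Q ≤ ν Q) : t * μ (⋃ Q ∈ T, Q) ≤ ν (⋃ Q ∈ T, Q) := by
  obtain ⟨U, hUT, hd, hcov⟩ := exists_pairwiseDisjoint_cover T hT
  have hU : (⋃ Q ∈ T, Q) = ⋃ Q ∈ U, id Q := by
    apply subset_antisymm
    · refine Set.iUnion₂_subset fun Q hQ => ?_
      obtain ⟨R, hR, hQR⟩ := hcov Q hQ
      exact hQR.trans (Set.subset_biUnion_of_mem (u := id) hR)
    · exact Set.iUnion₂_subset fun Q hQ => Set.subset_biUnion_of_mem (u := id) (hUT hQ)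
  rw [hU, measure_biUnion_finset hd fun Q hQ => hm Q (hUT hQ),
    measure_biUnion_finset hd fun Q hQ => hm Q (hUT hQ), Finset.mul_sum]
  exact Finset.sum_le_sum fun Q hQ => h Q (hUT hQ)

-- The bottom layer of the Carleson embedding: every member lies below a maximal one, and the
-- maximal ones are disjoint.
open Classical in
theorem sum_le_mul_measure_biUnion {T : Finset (Set X)} (hT : Laminar (T : Set (Set X)))
    (hm : ∀ Q ∈ T, MeasurableSet Q) (ν : Measure X) {a : Set X → ℝ≥0∞} {K : ℝ≥0∞}
    (h : ∀ R ∈ T, ∑ Q ∈ T with Q ⊆ R, a Q ≤ K * ν R) :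
    ∑ Q ∈ T, a Q ≤ K * ν (⋃ Q ∈ T, Q) := by
  obtain ⟨U, hUT, hd, hcov⟩ := exists_pairwiseDisjoint_cover T hT
  calc ∑ Q ∈ T, a Q ≤ ∑ Q ∈ T, ∑ R ∈ U, if Q ⊆ R then a Q else 0 := by
        refine Finset.sum_le_sum fun Q hQ => ?_
        obtain ⟨R, hR, hQR⟩ := hcov Q hQ
        calc a Q = if Q ⊆ R then a Q else 0 := (if_pos hQR).symm
          _ ≤ _ := Finset.single_le_sum (f := fun R => if Q ⊆ R then a Q else 0)
            (fun _ _ => zero_le) hR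
    _ = ∑ R ∈ U, ∑ Q ∈ T with Q ⊆ R, a Q := by
        rw [Finset.sum_comm]
        exact Finset.sum_congr rfl fun R _ => (Finset.sum_filter _ _).symm
    _ ≤ ∑ R ∈ U, K * ν R := Finset.sum_le_sum fun R hR => h R (hUT hR)
    _ = K * ν (⋃ Q ∈ U, id Q) := by
        rw [measure_biUnion_finset hd fun Q hQ => hm Q (hUT hQ), Finset.mul_sum]; rfl
    _ ≤ K * ν (⋃ Q ∈ T, Q) := by
        refine mul_le_mul' le_rfl (measure_mono ?_)
        exact Set.biUnion_mono hUT fun Q _ => subset_rfl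

open Classical in
/-- The Carleson embedding theorem for a finite laminar family. -/
theorem sum_mul_le_lintegral_familySup {T : Finset (Set X)} (hT : Laminar (T : Set (Set X)))
    (hm : ∀ Q ∈ T, MeasurableSet Q) (ν : Measure X) {a : Set X → ℝ≥0∞} {K : ℝ≥0∞}
    (h : ∀ R ∈ T, ∑ Q ∈ T with Q ⊆ R, a Q ≤ K * ν R) (c : Set X → ℝ≥0∞) :
    ∑ Q ∈ T, a Q * c Q ≤ K * ∫⁻ x, familySup (T : Set (Set X)) c x ∂ν := by
  induction T using Finset.strongInduction generalizing c with
  | H T ih =>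
    rcases T.eq_empty_or_nonempty with rfl | hne
    · simp
    -- Discrete layer cake: subtract the least value from all values. The layer removed is
    -- controlled on the whole union, and `Q₀` drops out of the remainder.
    obtain ⟨Q₀, hQ₀, hmin⟩ := T.exists_min_image c hne
    have hsub : T.erase Q₀ ⊆ T := Finset.erase_subset _ _
    have ih' := ih _ (Finset.erase_ssubset hQ₀) (hT.mono (by exact_mod_cast hsub))
      (fun Q hQ => hm Q (hsub hQ))
      (fun R hR => (Finset.sum_le_sum_of_subset
        (Finset.filter_subset_filter _ hsub)).trans (h R (hsub hR))) (fun Q => c Q - c Q₀)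
    have hUm : MeasurableSet (⋃ Q ∈ T, Q) := T.measurableSet_biUnion hm
    calc ∑ Q ∈ T, a Q * c Q = ∑ Q ∈ T, (a Q * c Q₀ + a Q * (c Q - c Q₀)) := by
          refine Finset.sum_congr rfl fun Q hQ => ?_
          rw [← mul_add, add_tsub_cancel_of_le (hmin Q hQ)]
      _ = (∑ Q ∈ T, a Q) * c Q₀ + ∑ Q ∈ T.erase Q₀, a Q * (c Q - c Q₀) := by
          rw [Finset.sum_add_distrib, Finset.sum_mul, Finset.sum_erase _ (by simp)]
      _ ≤ K * ν (⋃ Q ∈ T, Q) * c Q₀ + K * ∫⁻ x, familySup ((T.erase Q₀ : Finset _) : Set (Set X))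
            (fun Q => c Q - c Q₀) x ∂ν := by
          gcongr
          exact sum_le_mul_measure_biUnion hT hm ν h
      _ = K * ∫⁻ x, ((⋃ Q ∈ T, Q).indicator (fun _ => c Q₀) x +
            familySup ((T.erase Q₀ : Finset _) : Set (Set X)) (fun Q => c Q - c Q₀) x) ∂ν := by
          rw [lintegral_add_left (measurable_const.indicator hUm), lintegral_indicator_const hUm]
          ring
      _ ≤ K * ∫⁻ x, familySup (T : Set (Set X)) c x ∂ν := by
          gcongr with x
          by_cases hx : x ∈ ⋃ Q ∈ T, Q
          · rw [Set.indicator_of_mem hx]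
            obtain ⟨R, hR, hxR⟩ := Set.mem_iUnion₂.1 hx
            have h0 : c Q₀ ≤ familySup (T : Set (Set X)) c x :=
              (hmin R hR).trans (le_familySup (by exact_mod_cast hR) hxR)
            calc _ ≤ c Q₀ + (familySup (T : Set (Set X)) c x - c Q₀) := by
                  gcongr
                  refine familySup_le fun Q hQ hxQ => ?_
                  gcongr
                  exact le_familySup (by exact_mod_cast hsub hQ) hxQ
              _ = _ := add_tsub_cancel_of_le h0
          · rw [Set.indicator_of_notMem hx, zero_add]
            refine familySup_le fun Q hQ hxQ => ?_
            exact absurd (Set.mem_iUnion₂.2 ⟨Q, hsub hQ, hxQ⟩) hx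

/-- The weak type inequality for the maximal function of a finite laminar family. -/
theorem mul_measure_lt_familySup_le {T : Finset (Set X)} (hT : Laminar (T : Set (Set X)))
    (hm : ∀ Q ∈ T, MeasurableSet Q) (σ : Measure X) {F : X → ℝ≥0∞} (hF : Measurable F)
    (hfin : ∀ Q ∈ T, ∫⁻ x in Q, F x ∂σ ≠ ∞) (s : ℝ≥0∞) :
    s * σ {x | s + s < familySup (T : Set (Set X)) (fun Q => (∫⁻ x in Q, F x ∂σ) / σ Q) x} ≤
      σ.withDensity F {x | s < F x} := by
  classical
  set avg : Set X → ℝ≥0∞ := fun Q => (∫⁻ x in Q, F x ∂σ) / σ Q with havg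
  set E : Set X := {x | s < F x}
  have hE : MeasurableSet E := measurableSet_lt measurable_const hF
  let U := T.filter fun Q => s + s < avg Q
  have hUT : U ⊆ T := Finset.filter_subset _ _
  -- The part of `F` not exceeding `s` contributes at most `s * σ Q`, while the integral over `Q` is
  -- at least twice that; finiteness permits the cancellation.
  have key : ∀ Q ∈ U, s * σ Q ≤ (σ.withDensity F).restrict E Q := by
    intro Q hQ
    obtain ⟨hQT, hQ⟩ := Finset.mem_filter.1 hQ
    have h1 : s * σ Q + s * σ Q ≤ ∫⁻ x in Q, F x ∂σ := by
      rw [← add_mul]; exact ENNReal.mul_le_of_le_div hQ.le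
    have h2 : ∫⁻ x in Q, F x ∂σ ≤ (σ.withDensity F).restrict E Q + s * σ Q := by
      rw [Measure.restrict_apply (hm Q hQT), withDensity_apply _ ((hm Q hQT).inter hE)]
      calc ∫⁻ x in Q, F x ∂σ ≤ ∫⁻ x in Q, (E.indicator F x + s) ∂σ := by
            gcongr with x
            by_cases hx : x ∈ E
            · simp [hx]
            · simpa [hx] using not_lt.1 hx
        _ = _ := by
            rw [lintegral_add_right _ measurable_const, setLIntegral_const,
              lintegral_indicator hE, Measure.restrict_restrict hE, Set.inter_comm]
    have h3 : s * σ Q ≠ ∞ := ne_top_of_le_ne_top (hfin Q hQT) (le_self_add.trans h1)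
    exact (ENNReal.add_le_add_iff_right h3).1 (h1.trans h2)
  calc s * σ {x | s + s < familySup (T : Set (Set X)) avg x} ≤ s * σ (⋃ Q ∈ U, Q) := by
        gcongr
        intro x hx
        by_contra hxU
        refine absurd hx (not_lt.2 (familySup_le fun Q hQ hxQ => ?_))
        by_contra hlt
        exact hxU (Set.mem_iUnion₂.2 ⟨Q, Finset.mem_filter.2 ⟨by exact_mod_cast hQ,
          not_le.1 hlt⟩, hxQ⟩)
    _ ≤ (σ.withDensity F).restrict E (⋃ Q ∈ U, Q) :=
        mul_measure_biUnion_le (hT.mono (by exact_mod_cast hUT)) (fun Q hQ => hm Q (hUT hQ)) _ _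
          key
    _ ≤ (σ.withDensity F).restrict E Set.univ := measure_mono (Set.subset_univ _)
    _ = σ.withDensity F E := by simp

/-- The strong type inequality for the maximal function of a finite laminar family. -/
theorem lintegral_familySup_rpow_le {T : Finset (Set X)} (hT : Laminar (T : Set (Set X)))
    (hm : ∀ Q ∈ T, MeasurableSet Q) (σ : Measure X) {F : X → ℝ≥0∞} (hF : Measurable F)
    (hF' : ∀ x, F x ≠ ∞) (hσ : ∀ Q ∈ T, σ Q ≠ 0)
    (hfin : ∀ Q ∈ T, ∫⁻ x in Q, F x ∂σ ≠ ∞) {q : ℝ} (hq : 1 < q) :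
    ∫⁻ x, familySup (T : Set (Set X)) (fun Q => (∫⁻ x in Q, F x ∂σ) / σ Q) x ^ q ∂σ ≤
      ENNReal.ofReal (2 ^ q * q / (q - 1)) * ∫⁻ x, F x ^ q ∂σ := by
  set M := familySup (T : Set (Set X)) (fun Q => (∫⁻ x in Q, F x ∂σ) / σ Q) with hM
  have hMm : Measurable M := measurable_familySup (T.countable_toSet) (by exact_mod_cast hm) _
  have hMfin : ∀ x, M x ≠ ∞ := by
    intro x
    refine ne_top_of_le_ne_top (b := ∑ Q ∈ T, (∫⁻ x in Q, F x ∂σ) / σ Q) ?_ ?_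
    · exact ENNReal.sum_ne_top.2 fun Q hQ => ENNReal.div_ne_top (hfin Q hQ) (hσ Q hQ)
    · exact familySup_le fun Q hQ _ => Finset.single_le_sum (f := fun Q => (∫⁻ x in Q, F x ∂σ) / σ Q)
        (fun _ _ => zero_le) (by exact_mod_cast hQ)
  have hq0 : 0 < q := by linarith
  have hrpow : ∀ (a : ℝ≥0∞) (r : ℝ), a ≠ ∞ → 0 ≤ r → a ^ r = ENNReal.ofReal (a.toReal ^ r) := by
    intro a r ha hr
    rw [← ENNReal.ofReal_rpow_of_nonneg ENNReal.toReal_nonneg hr, ENNReal.ofReal_toReal ha]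
  have weak : ∀ t : ℝ, t ∈ Set.Ioi (0 : ℝ) →
      σ {x | t < (M x).toReal} * ENNReal.ofReal (t ^ (q - 1)) ≤
      2 * (σ.withDensity F {x | t < 2 * (F x).toReal} * ENNReal.ofReal (t ^ (q - 1 - 1))) := by
    intro t ht
    have ht0 : (0 : ℝ) < t := ht
    have h := mul_measure_lt_familySup_le hT hm σ hF hfin (ENNReal.ofReal (t / 2))
    have e1 : ENNReal.ofReal (t / 2) + ENNReal.ofReal (t / 2) = ENNReal.ofReal t := by
      rw [← ENNReal.ofReal_add (by positivity) (by positivity)]; congr 1; ring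
    have e2 : {x | ENNReal.ofReal t < M x} = {x | t < (M x).toReal} := by
      ext x; exact ENNReal.ofReal_lt_iff_lt_toReal ht0.le (hMfin x)
    have e3 : {x | ENNReal.ofReal (t / 2) < F x} = {x | t < 2 * (F x).toReal} := by
      ext x
      rw [Set.mem_ofPred_eq, ENNReal.ofReal_lt_iff_lt_toReal (by positivity) (hF' x),
        div_lt_iff₀' (by norm_num)]
      rfl
    rw [e1, ← hM, e2, e3] at h
    have e4 : ENNReal.ofReal (t ^ (q - 1)) =
        2 * (ENNReal.ofReal (t / 2) * ENNReal.ofReal (t ^ (q - 1 - 1))) := by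
      rw [← ENNReal.ofReal_mul (by positivity), show (2 : ℝ≥0∞) = ENNReal.ofReal 2 by simp,
        ← ENNReal.ofReal_mul (by positivity), Real.rpow_sub_one ht0.ne' (q - 1)]
      congr 1; field_simp
    rw [e4]
    calc _ = 2 * (ENNReal.ofReal (t / 2) * σ {x | t < (M x).toReal} *
          ENNReal.ofReal (t ^ (q - 1 - 1))) := by ring
      _ ≤ _ := by gcongr
  -- Layer cake for `M`, the weak bound at each height, then layer cake backwards for `2F` with
  -- exponent `q - 1` and the measure `F dσ`.
  calc ∫⁻ x, M x ^ q ∂σ = ∫⁻ x, ENNReal.ofReal ((M x).toReal ^ q) ∂σ :=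
        lintegral_congr fun x => hrpow _ _ (hMfin x) hq0.le
    _ = ENNReal.ofReal q * ∫⁻ t in Set.Ioi 0, σ {x | t < (M x).toReal} *
          ENNReal.ofReal (t ^ (q - 1)) :=
        lintegral_rpow_eq_lintegral_meas_lt_mul σ
          (Filter.Eventually.of_forall fun x => ENNReal.toReal_nonneg)
          hMm.ennreal_toReal.aemeasurable hq0
    _ ≤ ENNReal.ofReal q * ∫⁻ t in Set.Ioi 0, 2 * (σ.withDensity F
          {x | t < 2 * (F x).toReal} * ENNReal.ofReal (t ^ (q - 1 - 1))) := by
        gcongr 1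
        exact setLIntegral_mono' measurableSet_Ioi weak
    _ = ENNReal.ofReal (2 * q / (q - 1)) * (ENNReal.ofReal (q - 1) * ∫⁻ t in Set.Ioi 0,
          σ.withDensity F {x | t < 2 * (F x).toReal} * ENNReal.ofReal (t ^ (q - 1 - 1))) := by
        rw [lintegral_const_mul' _ _ (by simp), ← mul_assoc, ← mul_assoc,
          ← ENNReal.ofReal_mul (div_nonneg (by linarith) (by linarith)),
          div_mul_cancel₀ _ (by linarith), show (2 : ℝ≥0∞) = ENNReal.ofReal 2 by simp,
          ← ENNReal.ofReal_mul hq0.le, mul_comm q]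
    _ = ENNReal.ofReal (2 * q / (q - 1)) * ∫⁻ x, ENNReal.ofReal ((2 * (F x).toReal) ^ (q - 1))
          ∂σ.withDensity F := by
        rw [lintegral_rpow_eq_lintegral_meas_lt_mul (σ.withDensity F)
          (Filter.Eventually.of_forall fun x => by positivity)
          (hF.ennreal_toReal.const_mul 2).aemeasurable (by linarith)]
    _ = ENNReal.ofReal (2 * q / (q - 1)) * ∫⁻ x, ENNReal.ofReal (2 ^ (q - 1)) * F x ^ q ∂σ := by
        rw [lintegral_withDensity_eq_lintegral_mul _ hF (by fun_prop)]
        congr 1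
        refine lintegral_congr fun x => ?_
        have : F x ^ q = F x * F x ^ (q - 1) := by
          conv_lhs => rw [show q = 1 + (q - 1) by ring]
          rw [ENNReal.rpow_add_of_nonneg _ _ zero_le_one (by linarith), ENNReal.rpow_one]
        rw [this, Pi.mul_apply, Real.mul_rpow zero_le_two ENNReal.toReal_nonneg,
          ENNReal.ofReal_mul (by positivity), ← hrpow _ _ (hF' x) (by linarith)]
        ring
    _ = ENNReal.ofReal (2 ^ q * q / (q - 1)) * ∫⁻ x, F x ^ q ∂σ := by
        rw [lintegral_const_mul' _ _ (by simp), ← mul_assoc,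
          ← ENNReal.ofReal_mul (div_nonneg (by linarith) (by linarith))]
        congr 2
        rw [Real.rpow_sub_one two_ne_zero]; ring

/-! ### Sparseness of stopping families -/

section Sparse

variable {ι : Type*} [Fintype ι] [Nonempty ι]

/-- Sparseness of a family along which products of averages increase geometrically. -/
theorem two_mul_measure_biUnion_le {T : Finset (Set X)} (hT : Laminar (T : Set (Set X)))
    (hm : ∀ Q ∈ T, MeasurableSet Q) (μ : Measure X) {Q : Set X} (hQ0 : μ Q ≠ 0) (hQ : μ Q ≠ ∞)
    {g : ι → X → ℝ≥0∞} (hfin : ∀ i, ∫⁻ x in Q, g i x ∂μ ≠ ∞) (hsub : ∀ R ∈ T, R ⊆ Q)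
    (hinc : ∀ R ∈ T, ((2 * Fintype.card ι : ℕ) : ℝ≥0∞) ^ Fintype.card ι *
      ∏ i, (∫⁻ x in Q, g i x ∂μ) / μ Q < ∏ i, (∫⁻ x in R, g i x ∂μ) / μ R) :
    2 * μ (⋃ R ∈ T, R) ≤ μ Q := by
  classical
  set N := Fintype.card ι with hN
  have hN0 : N ≠ 0 := Fintype.card_ne_zero
  set b : ℝ≥0∞ := ((2 * N : ℕ) : ℝ≥0∞) with hb
  let U : ι → Finset (Set X) := fun i => T.filter fun R =>
    b * ((∫⁻ x in Q, g i x ∂μ) / μ Q) < (∫⁻ x in R, g i x ∂μ) / μ R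
  have hcov : (⋃ R ∈ T, R) ⊆ ⋃ i, ⋃ R ∈ U i, R := by
    refine Set.iUnion₂_subset fun R hR => ?_
    -- Pigeonhole: if every factor increased at most by `b = 2N`, the product would increase at most
    -- by `b ^ N`.
    obtain ⟨i, hi⟩ : ∃ i, b * ((∫⁻ x in Q, g i x ∂μ) / μ Q) < (∫⁻ x in R, g i x ∂μ) / μ R := by
      by_contra hcon
      push Not at hcon
      refine absurd (hinc R hR) (not_lt.2 ?_)
      calc _ ≤ ∏ i, b * ((∫⁻ x in Q, g i x ∂μ) / μ Q) := Finset.prod_le_prod' fun i _ => hcon i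
        _ = _ := by rw [Finset.prod_mul_distrib, Finset.prod_const, Finset.card_univ]
    have hRi : R ∈ U i := Finset.mem_filter.2 ⟨hR, hi⟩
    exact (Set.subset_biUnion_of_mem (u := fun R : Set X => R) hRi).trans
      (Set.subset_iUnion (fun i => ⋃ R ∈ U i, R) i)
  have hsmall : ∀ i, b * μ (⋃ R ∈ U i, R) ≤ μ Q := by
    intro i
    have hUT : U i ⊆ T := Finset.filter_subset _ _
    set A := (∫⁻ x in Q, g i x ∂μ) / μ Q with hA
    have hAtop : A ≠ ∞ := ENNReal.div_ne_top (hfin i) hQ0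
    by_cases hA0 : A = 0
    · have hz : ∫⁻ x in Q, g i x ∂μ = 0 := by
        rcases ENNReal.div_eq_zero_iff.1 hA0 with h | h
        · exact h
        · exact absurd h hQ
      have hU : U i = ∅ := by
        refine Finset.filter_eq_empty_iff.2 fun R hR => ?_
        have : ∫⁻ x in R, g i x ∂μ = 0 :=
          le_antisymm ((lintegral_mono_set (hsub R hR)).trans hz.le) zero_le
        simp [this]
      simp [hU]
    · have hUm : MeasurableSet (⋃ R ∈ U i, R) :=
        (U i).measurableSet_biUnion fun R hR => hm R (hUT hR)
      have h := mul_measure_biUnion_le (hT.mono (by exact_mod_cast hUT))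
        (fun R hR => hm R (hUT hR)) μ (μ.withDensity (g i)) (t := b * A) (fun R hR => by
          rw [withDensity_apply _ (hm R (hUT hR))]
          exact ENNReal.mul_le_of_le_div (Finset.mem_filter.1 hR).2.le)
      rw [withDensity_apply _ hUm] at h
      have h2 : ∫⁻ x in ⋃ R ∈ U i, R, g i x ∂μ ≤ A * μ Q := by
        rw [hA, ENNReal.div_mul_cancel hQ0 hQ]
        exact lintegral_mono_set (Set.iUnion₂_subset fun R hR => hsub R (hUT hR))
      have h3 := h.trans h2
      rw [mul_comm b, mul_assoc] at h3
      exact (ENNReal.mul_le_mul_iff_right hA0 hAtop).1 h3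
  have hsum : b * μ (⋃ R ∈ T, R) ≤ N * μ Q := by
    calc b * μ (⋃ R ∈ T, R) ≤ b * ∑ i, μ (⋃ R ∈ U i, R) := by
          gcongr
          refine (measure_mono hcov).trans ?_
          exact measure_iUnion_fintype_le _ _
      _ = ∑ i, b * μ (⋃ R ∈ U i, R) := Finset.mul_sum _ _ _
      _ ≤ ∑ _i : ι, μ Q := Finset.sum_le_sum fun i _ => hsmall i
      _ = N * μ Q := by simp [hN]
  have hb2 : b = N * 2 := by rw [hb]; push_cast; ring
  rw [hb2, mul_assoc] at hsum
  exact (ENNReal.mul_le_mul_iff_right (by exact_mod_cast hN0) (by simp)).1 hsum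

end Sparse

end Laminar

/-! ### The two-weight inequality for a finite laminar family -/

section LaminarWeights

variable {X : Type*} [MeasurableSpace X] {ι : Type*} [Fintype ι]

/-- The constant in the two-weight inequality for a laminar family. -/
def laminarConst (p : ℝ) (P : ι → ℝ) : ℝ≥0∞ :=
  2 * (((2 * Fintype.card ι : ℕ) : ℝ≥0∞) ^ Fintype.card ι) ^ p *
    ∏ i, ENNReal.ofReal (2 ^ P i * P i / (P i - 1)) ^ (p / P i)

theorem laminarConst_ne_top {p : ℝ} {P : ι → ℝ} (hp : 0 < p) (hP : ∀ i, 1 < P i) :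
    laminarConst p P ≠ ∞ := by
  refine ENNReal.mul_ne_top (ENNReal.mul_ne_top (by simp) ?_) (ENNReal.prod_ne_top fun i _ => ?_)
  · exact ENNReal.rpow_ne_top_of_nonneg hp.le
      (ENNReal.pow_ne_top (ENNReal.natCast_ne_top (2 * Fintype.card ι)))
  · exact ENNReal.rpow_ne_top_of_nonneg (div_nonneg hp.le (by linarith [hP i])) (by simp)

theorem laminarConst_ne_zero {p : ℝ} {P : ι → ℝ} (hp : 0 < p) (hP : ∀ i, 1 < P i) :
    laminarConst p P ≠ 0 := by
  refine mul_ne_zero (mul_ne_zero (by simp) ?_) (Finset.prod_ne_zero_iff.2 fun i _ => ?_)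
  · refine (ENNReal.rpow_pos_of_nonneg ?_ hp.le).ne'
    refine pos_iff_ne_zero.2 fun h => ?_
    obtain ⟨h1, h2⟩ := pow_eq_zero_iff'.1 h
    simp [h2] at h1
  · have h1 : 0 < P i := by linarith [hP i]
    have h2 : 0 < P i - 1 := by linarith [hP i]
    exact (ENNReal.rpow_pos_of_nonneg (ENNReal.ofReal_pos.2 (by positivity)) (by positivity)).ne'

/-- Removing from each selected set the smaller selected ones leaves disjoint sets `E Q` with at
least half the measure, and `h Q ≤ H` on `E Q`. Only the domain of integration is split, so `H` need
not be measurable; it will be built from maximal functions. -/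
theorem carleson_of_sparse {S : Finset (Set X)} (hS : Laminar (S : Set (Set X)))
    (hm : ∀ Q ∈ S, MeasurableSet Q) (μ : Measure X) (hμ : ∀ Q ∈ S, μ Q ≠ ∞)
    (hsparse : ∀ Q ∈ S, ∀ U : Finset (Set X), (∀ R, R ∈ U ↔ R ∈ S ∧ R ⊂ Q) →
      2 * μ (⋃ R ∈ U, R) ≤ μ Q) {R : Set X} {h : Set X → ℝ≥0∞} {H : X → ℝ≥0∞}
    (hH : ∀ Q ∈ S, Q ⊆ R → ∀ x ∈ Q, h Q ≤ H x) (U : Finset (Set X))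
    (hU : ∀ Q, Q ∈ U ↔ Q ∈ S ∧ Q ⊆ R) :
    ∑ Q ∈ U, μ Q * h Q ≤ 2 * ∫⁻ x in R, H x ∂μ := by
  classical
  let E : Set X → Set X := fun Q => Q \ ⋃ R ∈ S.filter (· ⊂ Q), R
  have hUm : ∀ Q, MeasurableSet (⋃ R ∈ S.filter (· ⊂ Q), R) := fun Q =>
    Finset.measurableSet_biUnion _ fun R hR => hm R (Finset.mem_filter.1 hR).1
  have hEm : ∀ Q ∈ S, MeasurableSet (E Q) := fun Q hQ => (hm Q hQ).diff (hUm Q)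
  have hE : ∀ Q ∈ S, μ Q ≤ 2 * μ (E Q) := by
    intro Q hQ
    have h1 := hsparse Q hQ (S.filter (· ⊂ Q)) (by simp)
    have h2 : μ Q ≤ μ (E Q) + μ (⋃ R ∈ S.filter (· ⊂ Q), R) :=
      (measure_mono (by simp [E])).trans (measure_union_le _ _)
    have h3 : μ Q + μ Q ≤ 2 * μ (E Q) + μ Q := by
      calc μ Q + μ Q = 2 * μ Q := (two_mul _).symm
        _ ≤ 2 * (μ (E Q) + μ (⋃ R ∈ S.filter (· ⊂ Q), R)) := by gcongr
        _ = 2 * μ (E Q) + 2 * μ (⋃ R ∈ S.filter (· ⊂ Q), R) := mul_add _ _ _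
        _ ≤ _ := by gcongr
    exact (ENNReal.add_le_add_iff_right (hμ Q hQ)).1 h3
  have hdisj : (U : Set (Set X)).PairwiseDisjoint E := by
    have aux : ∀ Q ∈ S, ∀ Q' ∈ S, Q ≠ Q' → Q ⊆ Q' → Disjoint (E Q) (E Q') := by
      intro Q hQ Q' hQ' hne hsub
      refine Set.disjoint_left.2 fun x hx hx' => hx'.2 ?_
      exact Set.mem_iUnion₂.2 ⟨Q, Finset.mem_filter.2 ⟨hQ, hsub.ssubset_of_ne hne⟩, hx.1⟩
    intro Q hQ Q' hQ' hne
    have hQS := ((hU Q).1 hQ).1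
    have hQS' := ((hU Q').1 hQ').1
    rcases hS Q hQS Q' hQS' with h | h | h
    · exact aux Q hQS Q' hQS' hne h
    · exact (aux Q' hQS' Q hQS hne.symm h).symm
    · exact h.mono Set.sdiff_subset Set.sdiff_subset
  calc ∑ Q ∈ U, μ Q * h Q ≤ ∑ Q ∈ U, 2 * ∫⁻ x in E Q, H x ∂μ := by
        refine Finset.sum_le_sum fun Q hQ => ?_
        obtain ⟨hQS, hQR⟩ := (hU Q).1 hQ
        calc μ Q * h Q ≤ 2 * μ (E Q) * h Q := by gcongr; exact hE Q hQS
          _ = 2 * ∫⁻ _ in E Q, h Q ∂μ := by rw [setLIntegral_const]; ring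
          _ ≤ 2 * ∫⁻ x in E Q, H x ∂μ := by
            gcongr 1
            exact setLIntegral_mono' (hEm Q hQS) fun x hx => hH Q hQS hQR x hx.1
    _ = 2 * ∫⁻ x in ⋃ Q ∈ U, E Q, H x ∂μ := by
        rw [lintegral_biUnion_finset hdisj fun Q hQ => hEm Q ((hU Q).1 hQ).1, Finset.mul_sum]
    _ ≤ 2 * ∫⁻ x in R, H x ∂μ := by
        gcongr 1
        refine lintegral_mono_set (Set.iUnion₂_subset fun Q hQ => ?_)
        exact Set.sdiff_subset.trans ((hU Q).1 hQ).2

/-- The two-weight inequality for the multisublinear maximal function of a finite laminar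
family. -/
theorem lintegral_familySup_prod_rpow_mul_le [Nonempty ι] {T : Finset (Set X)}
    (hT : Laminar (T : Set (Set X))) (hm : ∀ Q ∈ T, MeasurableSet Q) (μ : Measure X)
    (hμ0 : ∀ Q ∈ T, μ Q ≠ 0) (hμ : ∀ Q ∈ T, μ Q ≠ ∞) {p : ℝ} (hp : 0 < p) {P : ι → ℝ}
    (hP : ∀ i, 1 < P i) (hpP : 1 / p = ∑ i, 1 / P i) {V : X → ℝ≥0∞} (hV : Measurable V)
    {s F : ι → X → ℝ≥0∞} (hs : ∀ i, Measurable (s i)) (hF : ∀ i, Measurable (F i))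
    (hs0 : ∀ i, ∀ Q ∈ T, ∫⁻ x in Q, s i x ∂μ ≠ 0) (hsfin : ∀ i, ∀ Q ∈ T, ∫⁻ x in Q, s i x ∂μ ≠ ∞)
    (hFfin : ∀ i x, F i x ≠ ∞) (hFs : ∀ i, ∀ Q ∈ T, ∫⁻ x in Q, F i x * s i x ∂μ ≠ ∞)
    {A K : ℝ≥0∞}
    (hA : ∀ Q ∈ T, (∫⁻ x in Q, V x ∂μ) / μ Q *
      ∏ i, ((∫⁻ x in Q, s i x ∂μ) / μ Q) ^ (p / (P i).conjExponent) ≤ A)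
    {N : Set X → ι → X → ℝ≥0∞}
    (hN : ∀ i, ∀ Q ∈ T, ∀ R ∈ T, Q ⊆ R → ∀ x ∈ Q, (∫⁻ y in Q, s i y ∂μ) / μ Q ≤ N R i x)
    (hK : ∀ R ∈ T, ∫⁻ x in R, ∏ i, N R i x ^ (p / P i) ∂μ ≤
      K * ∫⁻ x in R, ∏ i, s i x ^ (p / P i) ∂μ) :
    ∫⁻ x, familySup (T : Set (Set X)) (fun Q => ∏ i, (∫⁻ y in Q, F i y * s i y ∂μ) / μ Q) x ^ p *
        V x ∂μ ≤
      laminarConst p P * (A * K) * ∏ i, (∫⁻ x, F i x ^ P i * s i x ∂μ) ^ (p / P i) := by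
  classical
  set a : ℝ≥0∞ := ((2 * Fintype.card ι : ℕ) : ℝ≥0∞) ^ Fintype.card ι with ha
  have ha1 : 1 ≤ a := by
    refine one_le_pow₀ ?_
    exact_mod_cast (by have := Fintype.card_pos (α := ι); omega : 1 ≤ 2 * Fintype.card ι)
  set l : Set X → ℝ≥0∞ := fun Q => ∏ i, (∫⁻ y in Q, F i y * s i y ∂μ) / μ Q with hl
  obtain ⟨S, hST, hcov, hinc⟩ := exists_principal_subfamily T l ha1
  have hSlam : Laminar (S : Set (Set X)) := hT.mono (by exact_mod_cast hST)
  have hSm : ∀ Q ∈ S, MeasurableSet Q := fun Q hQ => hm Q (hST hQ)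
  have hPpos : ∀ i, 0 < P i := fun i => by linarith [hP i]
  have hpPi : ∀ i, 0 ≤ p / P i := fun i => div_nonneg hp.le (hPpos i).le
  let σ : ι → Measure X := fun i => μ.withDensity (s i)
  have hσQ : ∀ i, ∀ Q ∈ T, σ i Q = ∫⁻ x in Q, s i x ∂μ := fun i Q hQ =>
    withDensity_apply _ (hm Q hQ)
  have hFσ : ∀ i, ∀ Q ∈ T, ∫⁻ x in Q, F i x ∂σ i = ∫⁻ x in Q, F i x * s i x ∂μ := by
    intro i Q hQ
    rw [setLIntegral_withDensity_eq_setLIntegral_mul _ (hs i) (hF i) (hm Q hQ)]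
    exact lintegral_congr fun x => mul_comm _ _
  let e : ι → Set X → ℝ≥0∞ := fun i Q => (∫⁻ x in Q, F i x ∂σ i) / σ i Q
  let w : Set X → ℝ≥0∞ := fun Q => ∏ i, ((∫⁻ x in Q, s i x ∂μ) / μ Q) ^ (p / P i)
  let c : Set X → ℝ≥0∞ := fun Q => ∏ i, e i Q ^ p
  set ν : Measure X := μ.withDensity fun x => ∏ i, s i x ^ (p / P i) with hν
  have hνm : Measurable fun x => ∏ i, s i x ^ (p / P i) :=
    Finset.measurable_prod _ fun i _ => (hs i).pow_const _
  -- domination by the principal sets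
  have hpt : ∀ x, familySup (T : Set (Set X)) l x ^ p ≤
      ∑ R ∈ S, R.indicator (fun _ => a ^ p * l R ^ p) x := by
    intro x
    rw [← ENNReal.le_rpow_inv_iff hp]
    refine familySup_le fun Q hQ hxQ => ?_
    rw [ENNReal.le_rpow_inv_iff hp]
    obtain ⟨R, hR, hQR, hle⟩ := hcov Q (by exact_mod_cast hQ)
    calc l Q ^ p ≤ (a * l R) ^ p := ENNReal.rpow_le_rpow hle hp.le
      _ = R.indicator (fun _ => a ^ p * l R ^ p) x := by
        rw [Set.indicator_of_mem (hQR hxQ), ENNReal.mul_rpow_of_nonneg _ _ hp.le]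
      _ ≤ _ := Finset.single_le_sum (f := fun R : Set X => R.indicator (fun _ => a ^ p * l R ^ p) x)
        (fun _ _ => zero_le) hR
  have hone : ∀ R ∈ S, l R ^ p * ∫⁻ x in R, V x ∂μ ≤ A * (μ R * w R * c R) := by
    intro R hR
    have hRT := hST hR
    -- The power `p` of each average of `s i` is shared out: `p / p_i'` goes to the `A_P` constant,
    -- `p / p_i` to the Carleson coefficient.
    have hsplit : l R ^ p = c R *
        ((∏ i, ((∫⁻ x in R, s i x ∂μ) / μ R) ^ (p / (P i).conjExponent)) * w R) := by
      rw [hl, ← Finset.prod_mul_distrib, ← Finset.prod_mul_distrib,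
        ← ENNReal.prod_rpow_of_nonneg hp.le]
      refine Finset.prod_congr rfl fun i _ => ?_
      have h1 : (∫⁻ y in R, F i y * s i y ∂μ) / μ R =
          e i R * ((∫⁻ x in R, s i x ∂μ) / μ R) := by
        simp only [e]
        rw [hFσ i R hRT, hσQ i R hRT, ← mul_div_assoc,
          ENNReal.div_mul_cancel (hs0 i R hRT) (hsfin i R hRT)]
      have hP1 : P i - 1 ≠ 0 := by linarith [hP i]
      have hP0 := (hPpos i).ne'
      have h2 : p / (P i).conjExponent + p / P i = p := by
        rw [Real.conjExponent]; field_simp; ring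
      have h3 : 0 ≤ p / (P i).conjExponent := by
        rw [Real.conjExponent]
        exact div_nonneg hp.le (div_nonneg (hPpos i).le (by linarith [hP i]))
      rw [h1, ENNReal.mul_rpow_of_nonneg _ _ hp.le, ← ENNReal.rpow_add_of_nonneg _ _ h3 (hpPi i),
        h2]
    calc l R ^ p * ∫⁻ x in R, V x ∂μ
        = l R ^ p * ((∫⁻ x in R, V x ∂μ) / μ R * μ R) := by
          rw [ENNReal.div_mul_cancel (hμ0 R hRT) (hμ R hRT)]
      _ = ((∫⁻ x in R, V x ∂μ) / μ R *
          ∏ i, ((∫⁻ x in R, s i x ∂μ) / μ R) ^ (p / (P i).conjExponent)) *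
            (μ R * w R * c R) := by rw [hsplit]; ring
      _ ≤ _ := by gcongr; exact hA R hRT
  have hsparse : ∀ Q ∈ S, ∀ U : Finset (Set X), (∀ R, R ∈ U ↔ R ∈ S ∧ R ⊂ Q) →
      2 * μ (⋃ R ∈ U, R) ≤ μ Q := by
    intro Q hQ U hU
    have hUS : U ⊆ S := fun R hR => ((hU R).1 hR).1
    exact two_mul_measure_biUnion_le (hSlam.mono (by exact_mod_cast hUS))
      (fun R hR => hSm R (hUS hR)) μ (hμ0 Q (hST hQ)) (hμ Q (hST hQ))
      (fun i => hFs i Q (hST hQ)) (fun R hR => ((hU R).1 hR).2.subset)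
      (fun R hR => hinc R (hUS hR) Q hQ ((hU R).1 hR).2)
  have hcarl : ∀ R ∈ S, ∑ Q ∈ S with Q ⊆ R, μ Q * w Q ≤ 2 * K * ν R := by
    intro R hR
    calc _ ≤ 2 * ∫⁻ x in R, ∏ i, N R i x ^ (p / P i) ∂μ := by
          refine carleson_of_sparse hSlam hSm μ (fun Q hQ => hμ Q (hST hQ)) hsparse ?_ _ (by simp)
          intro Q hQ hQR x hx
          exact Finset.prod_le_prod' fun i _ => ENNReal.rpow_le_rpow
            (hN i Q (hST hQ) R (hST hR) hQR x hx) (hpPi i)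
      _ ≤ 2 * (K * ∫⁻ x in R, ∏ i, s i x ^ (p / P i) ∂μ) := by
          gcongr 1
          exact hK R (hST hR)
      _ = 2 * K * ν R := by rw [hν, withDensity_apply _ (hSm R hR), mul_assoc]
  have hsum1 : ∑ i, p / P i = 1 := by
    have : ∀ i, p / P i = p * (1 / P i) := fun i => by ring
    rw [Finset.sum_congr rfl fun i _ => this i, ← Finset.mul_sum, ← hpP]
    field_simp
  have hMm : ∀ i, Measurable (familySup (S : Set (Set X)) (e i)) := fun i =>
    measurable_familySup S.countable_toSet (by exact_mod_cast hSm) _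
  -- Each factor `s i ^ (p / P i)` of the density of `ν` is paired with its own maximal function;
  -- the exponents `p / P i` sum to one, so Hölder applies.
  have hmax : ∫⁻ x, familySup (S : Set (Set X)) c x ∂ν ≤
      ∏ i, (ENNReal.ofReal (2 ^ P i * P i / (P i - 1)) *
        ∫⁻ x, F i x ^ P i * s i x ∂μ) ^ (p / P i) := by
    calc ∫⁻ x, familySup (S : Set (Set X)) c x ∂ν
        ≤ ∫⁻ x, ∏ i, familySup (S : Set (Set X)) (e i) x ^ p ∂ν := by
          refine lintegral_mono fun x => familySup_le fun Q hQ hxQ => ?_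
          exact Finset.prod_le_prod' fun i _ =>
            ENNReal.rpow_le_rpow (le_familySup hQ hxQ) hp.le
      _ = ∫⁻ x, ∏ i, (familySup (S : Set (Set X)) (e i) x ^ P i * s i x) ^ (p / P i) ∂μ := by
          rw [hν, lintegral_withDensity_eq_lintegral_mul _ hνm
            (Finset.measurable_prod _ fun i _ => (hMm i).pow_const _)]
          refine lintegral_congr fun x => ?_
          rw [Pi.mul_apply, ← Finset.prod_mul_distrib]
          refine Finset.prod_congr rfl fun i _ => ?_
          rw [ENNReal.mul_rpow_of_nonneg _ _ (hpPi i), ← ENNReal.rpow_mul,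
            mul_div_cancel₀ _ (hPpos i).ne', mul_comm]
      _ ≤ ∏ i, (∫⁻ x, familySup (S : Set (Set X)) (e i) x ^ P i * s i x ∂μ) ^ (p / P i) :=
          ENNReal.lintegral_prod_norm_pow_le _
            (fun i _ => (((hMm i).pow_const _).mul (hs i)).aemeasurable) hsum1 fun i _ => hpPi i
      _ ≤ _ := by
          refine Finset.prod_le_prod' fun i _ => ENNReal.rpow_le_rpow ?_ (hpPi i)
          have h := lintegral_familySup_rpow_le hSlam hSm (σ i) (hF i) (hFfin i)
            (fun Q hQ => by rw [hσQ i Q (hST hQ)]; exact hs0 i Q (hST hQ))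
            (fun Q hQ => by rw [hFσ i Q (hST hQ)]; exact hFs i Q (hST hQ)) (hP i)
          rw [lintegral_withDensity_eq_lintegral_mul _ (hs i) ((hMm i).pow_const _),
            lintegral_withDensity_eq_lintegral_mul _ (hs i) ((hF i).pow_const _)] at h
          simpa only [Pi.mul_apply, mul_comm (s i _)] using h
  calc ∫⁻ x, familySup (T : Set (Set X)) l x ^ p * V x ∂μ
      ≤ ∫⁻ x, ∑ R ∈ S, a ^ p * (l R ^ p * R.indicator V x) ∂μ := by
        refine lintegral_mono fun x => (mul_le_mul_left (hpt x) _).trans_eq ?_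
        rw [Finset.sum_mul]
        refine Finset.sum_congr rfl fun R _ => ?_
        by_cases hx : x ∈ R
        · simp only [Set.indicator_of_mem hx, mul_assoc]
        · simp [hx]
    _ = a ^ p * ∑ R ∈ S, l R ^ p * ∫⁻ x in R, V x ∂μ := by
        rw [lintegral_finsetSum _ fun R hR =>
          ((hV.indicator (hSm R hR)).const_mul _).const_mul _, Finset.mul_sum]
        refine Finset.sum_congr rfl fun R hR => ?_
        rw [lintegral_const_mul _ ((hV.indicator (hSm R hR)).const_mul _),
          lintegral_const_mul _ (hV.indicator (hSm R hR)), lintegral_indicator (hSm R hR)]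
    _ ≤ a ^ p * ∑ R ∈ S, A * (μ R * w R * c R) := by
        exact mul_le_mul' le_rfl (Finset.sum_le_sum hone)
    _ = a ^ p * A * ∑ R ∈ S, μ R * w R * c R := by rw [← Finset.mul_sum, mul_assoc]
    _ ≤ a ^ p * A * (2 * K * ∫⁻ x, familySup (S : Set (Set X)) c x ∂ν) := by
        refine mul_le_mul' le_rfl ?_
        exact sum_mul_le_lintegral_familySup hSlam hSm ν hcarl c
    _ ≤ a ^ p * A * (2 * K * ∏ i, (ENNReal.ofReal (2 ^ P i * P i / (P i - 1)) *
          ∫⁻ x, F i x ^ P i * s i x ∂μ) ^ (p / P i)) := by gcongr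
    _ = _ := by
        simp only [ENNReal.mul_rpow_of_nonneg _ _ (hpPi _), Finset.prod_mul_distrib, laminarConst]
        ring

end LaminarWeights

/-! ### Passage to countable families -/

section CountableFamily

variable {X : Type*} [MeasurableSpace X]

theorem lintegral_familySup_rpow_mul_le_of_finset {T : Set (Set X)} (hT : T.Countable)
    (hm : ∀ Q ∈ T, MeasurableSet Q) (c : Set X → ℝ≥0∞) {p : ℝ} (hp : 0 < p) (μ : Measure X)
    {V : X → ℝ≥0∞} (hV : Measurable V) {B : ℝ≥0∞}
    (h : ∀ U : Finset (Set X), (U : Set (Set X)) ⊆ T →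
      ∫⁻ x, familySup (U : Set (Set X)) c x ^ p * V x ∂μ ≤ B) :
    ∫⁻ x, familySup T c x ^ p * V x ∂μ ≤ B := by
  classical
  rcases T.eq_empty_or_nonempty with rfl | hne
  · simpa using h ∅ (by simp)
  obtain ⟨e, rfl⟩ := hT.exists_eq_range hne
  let U : ℕ → Finset (Set X) := fun N => (Finset.range N).image e
  have hU : ∀ N, (U N : Set (Set X)) ⊆ Set.range e := by
    intro N Q hQ
    obtain ⟨k, -, rfl⟩ := Finset.mem_image.1 hQ
    exact Set.mem_range_self k
  have hUm : Monotone fun N => familySup (U N : Set (Set X)) c := by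
    intro N N' hN x
    refine familySup_le fun Q hQ hx => le_familySup ?_ hx
    exact Finset.image_subset_image (Finset.range_mono hN) hQ
  calc ∫⁻ x, familySup (Set.range e) c x ^ p * V x ∂μ
      ≤ ∫⁻ x, ⨆ N, familySup (U N : Set (Set X)) c x ^ p * V x ∂μ := by
        refine lintegral_mono fun x => ?_
        rw [← ENNReal.iSup_mul]
        refine mul_le_mul_left ?_ _
        rw [← ENNReal.le_rpow_inv_iff hp]
        refine familySup_le fun Q hQ hx => ?_
        rw [ENNReal.le_rpow_inv_iff hp]
        obtain ⟨k, rfl⟩ := hQ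
        refine le_trans (ENNReal.rpow_le_rpow (le_familySup ?_ hx) hp.le)
          (le_iSup (fun N => familySup (U N : Set (Set X)) c x ^ p) (k + 1))
        exact Finset.mem_image_of_mem e (by simp)
    _ = ⨆ N, ∫⁻ x, familySup (U N : Set (Set X)) c x ^ p * V x ∂μ := by
        refine lintegral_iSup (fun N => ?_) fun N N' hN x => ?_
        · exact ((measurable_familySup (U N).countable_toSet (fun Q hQ => hm Q (hU N hQ)) c).pow_const
            _).mul hV
        · exact mul_le_mul_left (ENNReal.rpow_le_rpow (hUm hN x) hp.le) _
    _ ≤ B := iSup_le fun N => h _ (hU N)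

end CountableFamily

/-! ### Cubes and shifted dyadic grids -/

section Cubes

variable {n : ℕ}

theorem IsCube.measurableSet {Q : Set (Fin n → ℝ)} (hQ : IsCube Q) : MeasurableSet Q := by
  obtain ⟨a, l, -, rfl⟩ := hQ
  exact MeasurableSet.univ_pi fun _ => measurableSet_Ico

theorem volume_pi_Ico_add (a : Fin n → ℝ) (l : ℝ) :
    volume (Set.univ.pi fun j => Set.Ico (a j) (a j + l)) = ENNReal.ofReal l ^ n := by
  rw [Real.volume_pi_Ico]; simp

theorem IsCube.volume_ne_zero {Q : Set (Fin n → ℝ)} (hQ : IsCube Q) : volume Q ≠ 0 := by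
  obtain ⟨a, l, hl, rfl⟩ := hQ
  rw [volume_pi_Ico_add]
  exact pow_ne_zero _ (ENNReal.ofReal_pos.2 hl).ne'

theorem IsCube.volume_ne_top {Q : Set (Fin n → ℝ)} (hQ : IsCube Q) : volume Q ≠ ∞ := by
  obtain ⟨a, l, hl, rfl⟩ := hQ
  rw [volume_pi_Ico_add]
  exact ENNReal.pow_ne_top ENNReal.ofReal_ne_top

/-- Needed to extract integrability of the dual weights from the `A_P` constant, which says nothing
on cubes where `V` has no mass. -/
theorem IsCube.exists_superset_lintegral_ne_zero {Q : Set (Fin n → ℝ)} (hQ : IsCube Q)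
    {V : (Fin n → ℝ) → ℝ≥0∞} (hV : Measurable V) (hV0 : ¬ ∀ᵐ x, V x = 0) :
    ∃ R, IsCube R ∧ Q ⊆ R ∧ ∫⁻ x in R, V x ≠ 0 := by
  obtain ⟨a, l, hl, rfl⟩ := hQ
  by_contra! hcon
  apply hV0
  let R : ℕ → Set (Fin n → ℝ) := fun k =>
    Set.univ.pi fun j => Set.Ico (a j - k) (a j - k + (l + 2 * k))
  have hR : ∀ k, ∀ᵐ x ∂volume.restrict (R k), V x = 0 := by
    intro k
    have := hcon (R k) ⟨fun j => a j - k, l + 2 * k, by positivity, rfl⟩ ?_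
    · exact (lintegral_eq_zero_iff hV).1 this
    · refine Set.pi_mono fun j _ => Set.Ico_subset_Ico ?_ ?_
      · have : (0 : ℝ) ≤ k := by positivity
        linarith
      · have : (0 : ℝ) ≤ k := by positivity
        linarith
  have hun : (⋃ k, R k) = Set.univ := by
    refine Set.eq_univ_of_forall fun x => ?_
    obtain ⟨k, hk⟩ := exists_nat_gt (∑ j, |x j - a j|)
    refine Set.mem_iUnion.2 ⟨k, fun j _ => ?_⟩
    have h1 : |x j - a j| ≤ ∑ j, |x j - a j| :=
      Finset.single_le_sum (f := fun j => |x j - a j|) (fun _ _ => abs_nonneg _)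
        (Finset.mem_univ j)
    have h2 := abs_le.1 (h1.trans hk.le)
    constructor <;> linarith [h2.1, h2.2]
  have := (ae_restrict_iUnion_iff R fun x => V x = 0).2 hR
  rwa [hun, Measure.restrict_univ] at this

/-- The corner of a cube of a shifted dyadic grid. -/
def gridCorner (α : Fin n → Fin 2) (k : ℤ) (z : Fin n → ℤ) (j : Fin n) : ℝ :=
  2 ^ k * z j + ((α j : ℕ) : ℝ) * (-2) ^ k / 3

/-- A shifted dyadic grid. -/
def grid (α : Fin n → Fin 2) : Set (Set (Fin n → ℝ)) :=
  Set.range fun kz : ℤ × (Fin n → ℤ) =>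
    Set.univ.pi fun j => Set.Ico (gridCorner α kz.1 kz.2 j) (gridCorner α kz.1 kz.2 j + 2 ^ kz.1)

theorem countable_grid (α : Fin n → Fin 2) : (grid α).Countable :=
  Set.countable_range _

theorem isCube_of_mem_grid {α : Fin n → Fin 2} {Q : Set (Fin n → ℝ)} (hQ : Q ∈ grid α) :
    IsCube Q := by
  obtain ⟨⟨k, z⟩, rfl⟩ := hQ
  exact ⟨gridCorner α k z, 2 ^ k, by positivity, rfl⟩

theorem Ico_subset_Ico_of_commensurable {a b l x : ℝ} {M : ℤ} {N : ℕ} (hl : 0 < l)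
    (hab : b - a = l * M) (hxa : x ∈ Set.Ico a (a + l)) (hxb : x ∈ Set.Ico b (b + l * N)) :
    Set.Ico a (a + l) ⊆ Set.Ico b (b + l * N) := by
  have h1 : (M : ℝ) < 1 := by
    have : l * M < l * 1 := by linarith [hxa.2, hxb.1]
    exact lt_of_mul_lt_mul_left this hl.le
  have h2 : -(M : ℝ) < N := by
    have : l * -(M : ℝ) < l * N := by linarith [hxa.1, hxb.2]
    exact lt_of_mul_lt_mul_left this hl.le
  have h3 : M ≤ 0 := by
    have : M < 1 := by exact_mod_cast h1
    omega
  have h4 : -M + 1 ≤ (N : ℤ) := by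
    have : -M < (N : ℤ) := by exact_mod_cast h2
    omega
  have h3' : (M : ℝ) ≤ 0 := by exact_mod_cast h3
  have h4' : -(M : ℝ) + 1 ≤ N := by exact_mod_cast h4
  refine Set.Ico_subset_Ico ?_ ?_
  · nlinarith
  · nlinarith

/-- Between levels `k` and `k + d` the shift changes by `(-2)^k ((-2)^d - 1) / 3`, and `(-2)^d ≡ 1`
modulo 3. This is why the shifts alternate in sign. -/
theorem gridCorner_sub (α : Fin n → Fin 2) (k : ℤ) (d : ℕ) (z z' : Fin n → ℤ) (j : Fin n) :
    ∃ M : ℤ, gridCorner α (k + d) z' j - gridCorner α k z j = 2 ^ k * M := by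
  obtain ⟨u, hu⟩ : (3 : ℤ) ∣ (-2) ^ d - 1 := by
    have := sub_dvd_pow_sub_pow (-2 : ℤ) 1 d
    rw [one_pow] at this
    exact (by norm_num : (3 : ℤ) ∣ -2 - 1).trans this
  obtain ⟨ε, hε⟩ : ∃ ε : ℤ, ((-2 : ℝ)) ^ k = 2 ^ k * ε := by
    rcases Int.even_or_odd k with h | h
    · exact ⟨1, by rw [h.neg_zpow]; simp⟩
    · exact ⟨-1, by rw [h.neg_zpow]; simp⟩
  refine ⟨2 ^ d * z' j - z j + (α j : ℕ) * ε * u, ?_⟩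
  have hu' : ((-2 : ℝ)) ^ d = 3 * u + 1 := by
    have : ((-2 : ℤ)) ^ d = 3 * u + 1 := by linarith
    exact_mod_cast this
  unfold gridCorner
  rw [zpow_add₀ (by norm_num), zpow_add₀ (by norm_num), zpow_natCast, zpow_natCast, hε, hu']
  push_cast
  ring

theorem laminar_grid (α : Fin n → Fin 2) : Laminar (grid α) := by
  have key : ∀ (k : ℤ) (d : ℕ) (z z' : Fin n → ℤ),
      let Q := Set.univ.pi fun j => Set.Ico (gridCorner α k z j) (gridCorner α k z j + 2 ^ k)
      let R := Set.univ.pi fun j =>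
        Set.Ico (gridCorner α (k + d) z' j) (gridCorner α (k + d) z' j + 2 ^ (k + d))
      Q ⊆ R ∨ Disjoint Q R := by
    intro k d z z' Q R
    rw [or_iff_not_imp_right]
    intro h
    obtain ⟨x, hxQ, hxR⟩ := Set.not_disjoint_iff.1 h
    refine Set.pi_mono fun j hj => ?_
    obtain ⟨M, hM⟩ := gridCorner_sub α k d z z' j
    have hx := hxR j hj
    have e : (2 : ℝ) ^ (k + d) = 2 ^ k * ((2 ^ d : ℕ) : ℝ) := by
      rw [zpow_add₀ (by norm_num), zpow_natCast]; push_cast; rfl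
    simp only [e] at hx ⊢
    exact Ico_subset_Ico_of_commensurable (by positivity) hM (hxQ j hj) hx
  rintro _ ⟨⟨k, z⟩, rfl⟩ _ ⟨⟨k', z'⟩, rfl⟩
  rcases le_total k k' with h | h
  · obtain ⟨d, rfl⟩ := Int.le.dest h
    rcases key k d z z' with h | h
    · exact Or.inl h
    · exact Or.inr (Or.inr h)
  · obtain ⟨d, rfl⟩ := Int.le.dest h
    rcases key k' d z' z with h | h
    · exact Or.inr (Or.inl h)
    · exact Or.inr (Or.inr h.symm)

/-- Endpoints of the unshifted and the shifted grid at scale `2 ^ k` are at least `2 ^ k / 3` apart,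
so a shorter or equally long half-open interval cannot be cut by both. -/
theorem exists_grid_interval {c l : ℝ} {k : ℤ} (h : 3 * l ≤ 2 ^ k) :
    ∃ (α : Fin 2) (z : ℤ), Set.Ico c (c + l) ⊆
      Set.Ico (2 ^ k * (z : ℝ) + ((α : ℕ) : ℝ) * (-2) ^ k / 3)
        (2 ^ k * (z : ℝ) + ((α : ℕ) : ℝ) * (-2) ^ k / 3 + 2 ^ k) := by
  have hpos : (0 : ℝ) < 2 ^ k := by positivity
  obtain ⟨ε, hε, hε1⟩ : ∃ ε : ℤ, ((-2 : ℝ)) ^ k = 2 ^ k * ε ∧ (ε = 1 ∨ ε = -1) := by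
    rcases Int.even_or_odd k with h | h
    · exact ⟨1, by rw [h.neg_zpow]; simp, Or.inl rfl⟩
    · exact ⟨-1, by rw [h.neg_zpow]; simp, Or.inr rfl⟩
  rw [hε]
  set z₀ := ⌊c / 2 ^ k⌋
  set z₁ := ⌊(c - 2 ^ k * ε / 3) / 2 ^ k⌋
  have a0 : 2 ^ k * (z₀ : ℝ) ≤ c := by
    have := Int.floor_le (c / 2 ^ k)
    rwa [le_div_iff₀' hpos] at this
  have b0 : c < 2 ^ k * ((z₀ : ℝ) + 1) := by
    have := Int.lt_floor_add_one (c / 2 ^ k)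
    rwa [div_lt_iff₀' hpos] at this
  have a1 : 2 ^ k * (z₁ : ℝ) ≤ c - 2 ^ k * ε / 3 := by
    have := Int.floor_le ((c - 2 ^ k * ε / 3) / 2 ^ k)
    rwa [le_div_iff₀' hpos] at this
  have b1 : c - 2 ^ k * ε / 3 < 2 ^ k * ((z₁ : ℝ) + 1) := by
    have := Int.lt_floor_add_one ((c - 2 ^ k * ε / 3) / 2 ^ k)
    rwa [div_lt_iff₀' hpos] at this
  by_cases c0 : c + l ≤ 2 ^ k * ((z₀ : ℝ) + 1)
  · refine ⟨0, z₀, Set.Ico_subset_Ico ?_ ?_⟩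
    · simpa using a0
    · simp only [Fin.val_zero, Nat.cast_zero, zero_mul, zero_div]; linarith
  · by_cases c1 : c + l ≤ 2 ^ k * ((z₁ : ℝ) + 1) + 2 ^ k * ε / 3
    · refine ⟨1, z₁, Set.Ico_subset_Ico ?_ ?_⟩
      · simp only [Fin.val_one, Nat.cast_one, one_mul]; linarith
      · simp only [Fin.val_one, Nat.cast_one, one_mul]; linarith
    · exfalso
      push Not at c0 c1
      -- Two cuts inside an interval of length at most `2 ^ k / 3` make this integer zero, although
      -- 3 does not divide `ε = ±1`.
      have u : 3 * ((z₀ : ℝ) - z₁) - ε < 1 := by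
        refine lt_of_mul_lt_mul_left (a := (2 : ℝ) ^ k) ?_ hpos.le
        linarith
      have l' : -1 < 3 * ((z₀ : ℝ) - z₁) - ε := by
        refine lt_of_mul_lt_mul_left (a := (2 : ℝ) ^ k) ?_ hpos.le
        linarith
      have u' : 3 * (z₀ - z₁) - ε < 1 := by exact_mod_cast u
      have l'' : -1 < 3 * (z₀ - z₁) - ε := by exact_mod_cast l'
      omega

/-- The one-third trick: every cube lies in a comparable cube of one of the shifted grids. -/
theorem IsCube.exists_grid_superset {Q : Set (Fin n → ℝ)} (hQ : IsCube Q) :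
    ∃ (α : Fin n → Fin 2), ∃ R ∈ grid α, Q ⊆ R ∧ volume R ≤ 6 ^ n * volume Q := by
  obtain ⟨a, l, hl, rfl⟩ := hQ
  -- Here `2 ^ k < 3l ≤ 2 ^ (k + 1)`, so side `2 ^ (k + 1) < 6l` works. The shift is chosen
  -- separately in each coordinate, whence `2 ^ n` grids.
  obtain ⟨k, hk1, hk2⟩ := exists_mem_Ioc_zpow (show 0 < 3 * l by positivity) one_lt_two
  choose α z hz using fun j => exists_grid_interval (c := a j) (l := l) (k := k + 1) hk2
  refine ⟨α, _, ⟨(k + 1, z), rfl⟩, Set.pi_mono fun j _ => hz j, ?_⟩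
  simp only
  rw [volume_pi_Ico_add, volume_pi_Ico_add, ← mul_pow]
  gcongr
  rw [show (6 : ℝ≥0∞) = ENNReal.ofReal 6 by simp, ← ENNReal.ofReal_mul (by norm_num)]
  refine ENNReal.ofReal_le_ofReal ?_
  rw [zpow_add_one₀ two_ne_zero]
  linarith

variable {ι : Type*} [Fintype ι]

theorem prod_average_le_sum_familySup (g : ι → (Fin n → ℝ) → ℝ≥0∞) {Q : Set (Fin n → ℝ)}
    (hQ : IsCube Q) {x : Fin n → ℝ} (hx : x ∈ Q) :
    ∏ i, (∫⁻ y in Q, g i y) / volume Q ≤ (6 ^ n) ^ Fintype.card ι *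
      ∑ α, familySup (grid α) (fun R => ∏ i, (∫⁻ y in R, g i y) / volume R) x := by
  obtain ⟨α, R, hR, hQR, hvol⟩ := hQ.exists_grid_superset
  have hRc := isCube_of_mem_grid hR
  calc ∏ i, (∫⁻ y in Q, g i y) / volume Q
      ≤ ∏ i, 6 ^ n * ((∫⁻ y in R, g i y) / volume R) := by
        refine Finset.prod_le_prod' fun i _ => ?_
        refine ENNReal.div_le_of_le_mul ?_
        calc ∫⁻ y in Q, g i y ≤ ∫⁻ y in R, g i y := lintegral_mono_set hQR
          _ = (∫⁻ y in R, g i y) / volume R * volume R :=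
            (ENNReal.div_mul_cancel hRc.volume_ne_zero hRc.volume_ne_top).symm
          _ ≤ (∫⁻ y in R, g i y) / volume R * (6 ^ n * volume Q) := by gcongr
          _ = _ := by ring
    _ = (6 ^ n) ^ Fintype.card ι * ∏ i, (∫⁻ y in R, g i y) / volume R := by
        rw [Finset.prod_mul_distrib, Finset.prod_const, Finset.card_univ]
    _ ≤ _ := by
        gcongr 1
        refine (le_familySup (c := fun R => ∏ i, (∫⁻ y in R, g i y) / volume R) hR
          (hQR hx)).trans ?_
        exact Finset.single_le_sum (f := fun α => familySup (grid α)
          (fun R => ∏ i, (∫⁻ y in R, g i y) / volume R) x) (fun _ _ => zero_le)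
          (Finset.mem_univ α)

end Cubes

/-! ### Degenerate weights and the inequality on a grid -/

/-- Comparison with the largest term covers `p < 1` and `p ≥ 1` alike. -/
theorem sum_rpow_le_card_rpow_mul {κ : Type*} [Fintype κ] [Nonempty κ] (u : κ → ℝ≥0∞) {p : ℝ}
    (hp : 0 ≤ p) : (∑ k, u k) ^ p ≤ (Fintype.card κ : ℝ≥0∞) ^ p * ∑ k, u k ^ p := by
  obtain ⟨k₀, -, hk₀⟩ := Finset.exists_max_image Finset.univ u Finset.univ_nonempty
  calc (∑ k, u k) ^ p ≤ (Fintype.card κ * u k₀) ^ p := by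
        refine ENNReal.rpow_le_rpow ?_ hp
        calc ∑ k, u k ≤ ∑ _k : κ, u k₀ := Finset.sum_le_sum hk₀
          _ = _ := by simp
    _ = (Fintype.card κ : ℝ≥0∞) ^ p * u k₀ ^ p := ENNReal.mul_rpow_of_nonneg _ _ hp
    _ ≤ _ := by
        gcongr
        exact Finset.single_le_sum (f := fun k => u k ^ p) (fun _ _ => zero_le)
          (Finset.mem_univ k₀)

variable {n : ℕ} {ι : Type*} [Fintype ι]

theorem setLIntegral_ne_zero_of_isCube {s : (Fin n → ℝ) → ℝ≥0∞} (hs : Measurable s)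
    (hs0 : ∀ᵐ x, s x ≠ 0) {Q : Set (Fin n → ℝ)} (hQ : IsCube Q) : ∫⁻ x in Q, s x ≠ 0 := by
  intro h
  rw [lintegral_eq_zero_iff hs] at h
  have h2 : ∀ᵐ _x ∂volume.restrict Q, False := by
    filter_upwards [h, ae_restrict_of_ae hs0] with x h1 h2 using h2 h1
  rw [Filter.eventually_false_iff_eq_bot, ae_eq_bot, Measure.restrict_eq_zero] at h2
  exact hQ.volume_ne_zero h2

/-- Finiteness of a two-weight constant forces local integrability of the dual weights. -/
theorem setLIntegral_ne_top_of_isCube {V : (Fin n → ℝ) → ℝ≥0∞} (hV : Measurable V)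
    (hV0 : ¬ ∀ᵐ x, V x = 0) {s : ι → (Fin n → ℝ) → ℝ≥0∞} (hs : ∀ i, Measurable (s i))
    (hs0 : ∀ i, ∀ᵐ x, s i x ≠ 0) {r : ι → ℝ} (hr : ∀ i, 0 < r i) {A : ℝ≥0∞} (hA' : A ≠ ∞)
    (hA : ∀ Q, IsCube Q → (∫⁻ x in Q, V x) / volume Q *
      ∏ i, ((∫⁻ x in Q, s i x) / volume Q) ^ r i ≤ A)
    {Q : Set (Fin n → ℝ)} (hQ : IsCube Q) (i : ι) : ∫⁻ x in Q, s i x ≠ ∞ := by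
  classical
  obtain ⟨R, hR, hQR, hVR⟩ := hQ.exists_superset_lintegral_ne_zero hV hV0
  refine ne_top_of_le_ne_top (fun htop => hA' ?_) (lintegral_mono_set hQR)
  have hdiv0 : ∀ j, ((∫⁻ x in R, s j x) / volume R) ^ r j ≠ 0 := fun j =>
    (ENNReal.rpow_pos_of_nonneg (ENNReal.div_pos (setLIntegral_ne_zero_of_isCube (hs j) (hs0 j) hR)
      hR.volume_ne_top) (hr j).le).ne'
  have h := hA R hR
  rw [← Finset.mul_prod_erase _ _ (Finset.mem_univ i), htop,
    ENNReal.top_div_of_ne_top hR.volume_ne_top, ENNReal.top_rpow_of_pos (hr i),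
    ENNReal.top_mul (Finset.prod_ne_zero_iff.2 fun j _ => hdiv0 j),
    ENNReal.mul_top (ENNReal.div_pos hVR hR.volume_ne_top).ne'] at h
  exact top_le_iff.1 h

/-- The two-weight inequality for the multisublinear maximal function of a shifted dyadic
grid. -/
theorem lintegral_familySup_grid_rpow_mul_le [Nonempty ι] (α : Fin n → Fin 2) {p : ℝ} (hp : 0 < p)
    {P : ι → ℝ} (hP : ∀ i, 1 < P i) (hpP : 1 / p = ∑ i, 1 / P i)
    {V : (Fin n → ℝ) → ℝ≥0∞} (hV : Measurable V) {s F : ι → (Fin n → ℝ) → ℝ≥0∞}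
    (hs : ∀ i, Measurable (s i)) (hF : ∀ i, Measurable (F i)) (hs0 : ∀ i, ∀ᵐ x, s i x ≠ 0)
    (hFfin : ∀ i x, F i x ≠ ∞) (hB : ∀ i, ∫⁻ x, F i x ^ P i * s i x ≠ ∞) {A K : ℝ≥0∞}
    (hA : ∀ Q, IsCube Q → (∫⁻ x in Q, V x) / volume Q *
      ∏ i, ((∫⁻ x in Q, s i x) / volume Q) ^ (p / (P i).conjExponent) ≤ A)
    (hK0 : K ≠ 0) {N : Set (Fin n → ℝ) → ι → (Fin n → ℝ) → ℝ≥0∞}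
    (hN : ∀ i, ∀ Q, IsCube Q → ∀ R, IsCube R → Q ⊆ R → ∀ x ∈ Q,
      (∫⁻ y in Q, s i y) / volume Q ≤ N R i x)
    (hK : ∀ R, IsCube R → ∫⁻ x in R, ∏ i, N R i x ^ (p / P i) ≤
      K * ∫⁻ x in R, ∏ i, s i x ^ (p / P i)) :
    ∫⁻ x, familySup (grid α) (fun Q => ∏ i, (∫⁻ y in Q, F i y * s i y) / volume Q) x ^ p * V x ≤
      laminarConst p P * (A * K) * ∏ i, (∫⁻ x, F i x ^ P i * s i x) ^ (p / P i) := by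
  have hPpos : ∀ i, 0 < P i := fun i => by linarith [hP i]
  have hpPi : ∀ i, 0 < p / P i := fun i => div_pos hp (hPpos i)
  have hr : ∀ i, 0 < p / (P i).conjExponent := fun i => by
    rw [Real.conjExponent]
    exact div_pos hp (div_pos (hPpos i) (by linarith [hP i]))
  -- If `V` or some norm vanishes, the left side is zero; otherwise `A = ∞` makes the right side
  -- infinite because `K ≠ 0`. In the remaining case `A` is finite and the dual weights are locally
  -- integrable.
  by_cases hV0 : ∀ᵐ x, V x = 0
  · rw [lintegral_congr_ae (g := fun _ => 0) (by filter_upwards [hV0] with x hx; simp [hx])]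
    simp
  by_cases hB0 : ∃ i, ∫⁻ x, F i x ^ P i * s i x = 0
  · obtain ⟨i, hi⟩ := hB0
    have hFs0 : ∀ᵐ x, F i x * s i x = 0 := by
      filter_upwards [(lintegral_eq_zero_iff (((hF i).pow_const _).mul (hs i))).1 hi] with x hx
      rcases mul_eq_zero.1 hx with h | h
      · rw [(ENNReal.rpow_eq_zero_iff_of_pos (hPpos i)).1 h, zero_mul]
      · rw [h, mul_zero]
    have hz : ∀ Q : Set (Fin n → ℝ), ∏ i, (∫⁻ y in Q, F i y * s i y) / volume Q = 0 := by
      intro Q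
      refine Finset.prod_eq_zero (Finset.mem_univ i) ?_
      rw [lintegral_congr_ae (g := fun _ => 0) (ae_restrict_of_ae hFs0)]
      simp
    have hfs : ∀ x, familySup (grid α)
        (fun Q => ∏ i, (∫⁻ y in Q, F i y * s i y) / volume Q) x = 0 := fun x =>
      le_antisymm (familySup_le fun Q _ _ => (hz Q).le) zero_le
    simp [hfs, hp]
  push Not at hB0
  by_cases hAtop : A = ∞
  · have : laminarConst p P * (A * K) * ∏ i, (∫⁻ x, F i x ^ P i * s i x) ^ (p / P i) = ∞ := by
      rw [hAtop, ENNReal.top_mul hK0, ENNReal.mul_top (laminarConst_ne_zero hp hP),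
        ENNReal.top_mul]
      exact Finset.prod_ne_zero_iff.2 fun i _ =>
        (ENNReal.rpow_pos_of_nonneg (pos_iff_ne_zero.2 (hB0 i)) (hpPi i).le).ne'
    rw [this]
    exact le_top
  have hsfin : ∀ i, ∀ Q, IsCube Q → ∫⁻ x in Q, s i x ≠ ∞ := fun i Q hQ =>
    setLIntegral_ne_top_of_isCube hV hV0 hs hs0 hr hAtop hA hQ i
  have hFs : ∀ i, ∀ Q, IsCube Q → ∫⁻ x in Q, F i x * s i x ≠ ∞ := by
    intro i Q hQ
    -- Pointwise `F ≤ 1 + F ^ P`, since `P > 1`.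
    refine ne_top_of_le_ne_top (b := (∫⁻ x in Q, s i x) + ∫⁻ x, F i x ^ P i * s i x) ?_ ?_
    · exact ENNReal.add_ne_top.2 ⟨hsfin i Q hQ, hB i⟩
    · calc ∫⁻ x in Q, F i x * s i x ≤ ∫⁻ x in Q, (s i x + F i x ^ P i * s i x) := by
            refine lintegral_mono fun x => ?_
            rcases le_total (F i x) 1 with h | h
            · exact (mul_le_of_le_one_left' h).trans le_self_add
            · refine le_trans ?_ le_add_self
              gcongr
              exact ENNReal.le_rpow_self_of_one_le h (hP i).le
        _ = (∫⁻ x in Q, s i x) + ∫⁻ x in Q, F i x ^ P i * s i x := lintegral_add_left (hs i) _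
        _ ≤ _ := by gcongr; exact Measure.restrict_le_self
  refine lintegral_familySup_rpow_mul_le_of_finset (countable_grid α)
    (fun Q hQ => (isCube_of_mem_grid hQ).measurableSet) _ hp volume hV fun U hU => ?_
  have hUc : ∀ Q ∈ U, IsCube Q := fun Q hQ => isCube_of_mem_grid (hU hQ)
  exact lintegral_familySup_prod_rpow_mul_le ((laminar_grid α).mono hU)
    (fun Q hQ => (hUc Q hQ).measurableSet) volume (fun Q hQ => (hUc Q hQ).volume_ne_zero)
    (fun Q hQ => (hUc Q hQ).volume_ne_top) hp hP hpP hV hs hF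
    (fun i Q hQ => setLIntegral_ne_zero_of_isCube (hs i) (hs0 i) (hUc Q hQ))
    (fun i Q hQ => hsfin i Q (hUc Q hQ)) hFfin (fun i Q hQ => hFs i Q (hUc Q hQ))
    (fun Q hQ => hA Q (hUc Q hQ))
    (fun i Q hQ R hR => hN i Q (hUc Q hQ) R (hUc R hR)) fun R hR => hK R (hUc R hR)

/-- The value `∞` of `ratio` at `b = ∞` is what makes this hold without finiteness of the
denominator. -/
theorem le_ratio_mul {a b : ℝ≥0∞} (hb : b ≠ 0) : a ≤ ratio a b * b := by
  unfold ratio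
  split_ifs with h
  · rw [ENNReal.top_mul hb]; exact le_top
  · rw [ENNReal.div_mul_cancel hb h]

theorem ratio_ne_zero {a b : ℝ≥0∞} (ha : a ≠ 0) : ratio a b ≠ 0 := by
  unfold ratio
  split_ifs with h
  · simp
  · exact (ENNReal.div_pos ha h).ne'

theorem le_maximal_indicator (u : (Fin n → ℝ) → ℝ) {Q R : Set (Fin n → ℝ)} (hQ : IsCube Q)
    (hQR : Q ⊆ R) {x : Fin n → ℝ} (hx : x ∈ Q) :
    (∫⁻ y in Q, ENNReal.ofReal (u y)) / volume Q ≤ maximal (R.indicator u) x := by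
  refine le_trans ?_ (le_iSup₂_of_le (f := fun Q (_ : IsCube Q) => ⨆ (_ : x ∈ Q),
    ⨍⁻ y in Q, ‖R.indicator u y‖ₑ ∂volume) Q hQ (le_iSup_of_le hx le_rfl))
  rw [setLAverage_eq]
  gcongr 1
  refine setLIntegral_mono' hQ.measurableSet fun y hy => ?_
  rw [Set.indicator_of_mem (hQR hy), Real.enorm_eq_ofReal_abs]
  exact ENNReal.ofReal_le_ofReal (le_abs_self _)

end MultiWeight

end

/-! ### The theorem on `ℝⁿ` -/

theorem theorem3p4 (n m : ℕ) (hn : 1 ≤ n) (hm : 1 ≤ m) (p : ℝ) (P : Fin m → ℝ)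
    (hP : ∀ i, 1 < P i) (hp : 1 / p = ∑ i, 1 / P i) :
    ∃ C : ℝ≥0, ∀ (v : (Fin n → ℝ) → ℝ) (w σ : Fin m → (Fin n → ℝ) → ℝ),
      MultiWeight.IsWeight v →
      (∀ i, MultiWeight.IsWeight (w i)) → (∀ i, ∀ᵐ x, 0 < w i x) →
      (∀ i, σ i = MultiWeight.dualWeight (P i) (w i)) →
      ∀ f : Fin m → (Fin n → ℝ) → ℂ,
        (∀ i, MemLp (f i) (ENNReal.ofReal (P i)) (MultiWeight.wMeasure (σ i))) →
        eLpNorm (MultiWeight.multiMaximal fun i x => f i x * (σ i x : ℂ))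
            (ENNReal.ofReal p) (MultiWeight.wMeasure v) ≤
          C * (MultiWeight.apConst p P v w * MultiWeight.wInftyConst p P σ) ^ (1 / p) *
            ∏ i, eLpNorm (f i) (ENNReal.ofReal (P i)) (MultiWeight.wMeasure (σ i)) := by
  classical
  open MultiWeight in
  have : Nonempty (Fin m) := ⟨⟨0, hm⟩⟩
  have hPpos : ∀ i, 0 < P i := fun i => by linarith [hP i]
  have hp0 : 0 < p := by
    have : 0 < 1 / p := by
      rw [hp]; exact Finset.sum_pos (fun i _ => by have := hPpos i; positivity) Finset.univ_nonempty
    exact one_div_pos.1 this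
  have hpPi : ∀ i, 0 < p / P i := fun i => div_pos hp0 (hPpos i)
  set D : ℝ≥0∞ := ((6 ^ n) ^ m) ^ p * ((Fintype.card (Fin n → Fin 2) : ℝ≥0∞) ^ p *
    (Fintype.card (Fin n → Fin 2) * laminarConst p P)) with hD
  have hDtop : D ≠ ∞ := by
    refine ENNReal.mul_ne_top (ENNReal.rpow_ne_top_of_nonneg hp0.le
      (ENNReal.pow_ne_top (ENNReal.pow_ne_top (by simp)))) (ENNReal.mul_ne_top ?_ ?_)
    · exact ENNReal.rpow_ne_top_of_nonneg hp0.le (ENNReal.natCast_ne_top _)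
    · exact ENNReal.mul_ne_top (ENNReal.natCast_ne_top _) (laminarConst_ne_top hp0 hP)
  have hDp : D ^ (1 / p) ≠ ∞ := ENNReal.rpow_ne_top_of_nonneg (by positivity) hDtop
  refine ⟨(D ^ (1 / p)).toNNReal, ?_⟩
  intro v w σ hv hw hw0 hσ f hf
  rw [ENNReal.coe_toNNReal hDp]
  -- the dual weights
  have hσm : ∀ i, AEMeasurable (σ i) := fun i => by
    rw [hσ i]; exact (hw i).1.pow_const _
  have hσpos : ∀ i, ∀ᵐ x, 0 < σ i x := fun i => by
    filter_upwards [hw0 i] with x hx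
    rw [hσ i]; exact Real.rpow_pos_of_pos hx _
  have hs'm : ∀ i, AEMeasurable (fun x => ENNReal.ofReal (σ i x)) := fun i => (hσm i).ennreal_ofReal
  have hs'0 : ∀ i, ∀ᵐ x, ENNReal.ofReal (σ i x) ≠ 0 := fun i => by
    filter_upwards [hσpos i] with x hx using (ENNReal.ofReal_pos.2 hx).ne'
  -- As `σ i > 0` almost everywhere, measurability of `f i` for `σ i dx` passes to Lebesgue measure.
  have hac : ∀ i, (volume : Measure (Fin n → ℝ)) ≪ wMeasure (σ i) := fun i =>
    withDensity_absolutelyContinuous' (hs'm i) (hs'0 i)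
  have hfm : ∀ i, AEStronglyMeasurable (f i) volume := fun i => (hf i).1.mono_ac (hac i)
  -- measurable representatives
  let s : Fin m → (Fin n → ℝ) → ℝ≥0∞ := fun i => (hs'm i).mk
  have hsm : ∀ i, Measurable (s i) := fun i => (hs'm i).measurable_mk
  have hs : ∀ i, ∀ᵐ x, ENNReal.ofReal (σ i x) = s i x := fun i => (hs'm i).ae_eq_mk
  let F : Fin m → (Fin n → ℝ) → ℝ≥0∞ := fun i x => ‖(hfm i).mk (f i) x‖ₑ
  have hFm : ∀ i, Measurable (F i) := fun i => (hfm i).stronglyMeasurable_mk.measurable.enorm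
  have hF : ∀ i, ∀ᵐ x, ‖f i x‖ₑ = F i x := fun i => by
    filter_upwards [(hfm i).ae_eq_mk] with x hx; simp only [F, ← hx]
  let V : (Fin n → ℝ) → ℝ≥0∞ := hv.1.ennreal_ofReal.mk
  have hVm : Measurable V := hv.1.ennreal_ofReal.measurable_mk
  have hV : ∀ᵐ x, ENNReal.ofReal (v x) = V x := hv.1.ennreal_ofReal.ae_eq_mk
  have hs0 : ∀ i, ∀ᵐ x, s i x ≠ 0 := fun i => by
    filter_upwards [hs i, hs'0 i] with x h1 h2; rwa [← h1]
  have hsQ : ∀ i (Q : Set (Fin n → ℝ)), ∫⁻ x in Q, ENNReal.ofReal (σ i x) = ∫⁻ x in Q, s i x :=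
    fun i Q => lintegral_congr_ae (ae_restrict_of_ae (hs i))
  have hsrQ : ∀ Q : Set (Fin n → ℝ), ∫⁻ x in Q, ∏ i, ENNReal.ofReal (σ i x) ^ (p / P i) =
      ∫⁻ x in Q, ∏ i, s i x ^ (p / P i) := fun Q => by
    refine lintegral_congr_ae (ae_restrict_of_ae ?_)
    filter_upwards [ae_all_iff.2 hs] with x hx
    simp only [hx]
  have hfs : ∀ i, ∀ᵐ x, ‖f i x * (σ i x : ℂ)‖ₑ = F i x * s i x := fun i => by
    filter_upwards [hs i, hF i, hσpos i] with x h1 h2 h3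
    rw [enorm_mul, h2, ← h1, ← ofReal_norm, Complex.norm_real, Real.norm_of_nonneg h3.le]
  have hnorm : ∀ i, eLpNorm (f i) (ENNReal.ofReal (P i)) (wMeasure (σ i)) =
      (∫⁻ x, F i x ^ P i * s i x) ^ (1 / P i) := fun i => by
    rw [eLpNorm_eq_lintegral_rpow_enorm_toReal (by simpa using hPpos i) (by simp),
      ENNReal.toReal_ofReal (hPpos i).le, wMeasure,
      lintegral_withDensity_eq_lintegral_mul₀ (hs'm i) ((hfm i).enorm.pow_const _)]
    congr 1
    refine lintegral_congr_ae ?_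
    filter_upwards [hs i, hF i] with x h1 h2
    rw [Pi.mul_apply, h1, h2, mul_comm]
  have hB : ∀ i, ∫⁻ x, F i x ^ P i * s i x ≠ ∞ := fun i h => by
    have := (hf i).2.ne
    rw [hnorm i, h, ENNReal.top_rpow_of_pos (by have := hPpos i; positivity)] at this
    exact this rfl
  -- the weight constants
  set A := apConst p P v w with hAdef
  set K := wInftyConst p P σ with hKdef
  have hA : ∀ Q, IsCube Q → (∫⁻ x in Q, V x) / volume Q *
      ∏ i, ((∫⁻ x in Q, s i x) / volume Q) ^ (p / (P i).conjExponent) ≤ A := by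
    intro Q hQ
    refine le_trans (le_of_eq ?_) (le_iSup₂ (f := fun Q (_ : IsCube Q) =>
      (⨍⁻ x in Q, ENNReal.ofReal (v x) ∂volume) *
        ∏ i, (⨍⁻ x in Q, ENNReal.ofReal (dualWeight (P i) (w i) x) ∂volume) ^
          (p / (P i).conjExponent)) Q hQ)
    simp only [setLAverage_eq, ← hσ, hsQ]
    rw [lintegral_congr_ae (ae_restrict_of_ae hV)]
  have hKle : ∀ R, IsCube R → ratio (∫⁻ x in R, ∏ i, maximal (R.indicator (σ i)) x ^ (p / P i))
      (∫⁻ x in R, ∏ i, s i x ^ (p / P i)) ≤ K := by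
    intro R hR
    rw [← hsrQ]
    exact le_iSup₂ (f := fun Q (_ : IsCube Q) =>
      ratio (∫⁻ x in Q, ∏ i, maximal (Q.indicator (σ i)) x ^ (p / P i))
        (∫⁻ x in Q, ∏ i, ENNReal.ofReal (σ i x) ^ (p / P i))) R hR
  have hden : ∀ R : Set (Fin n → ℝ), IsCube R → ∫⁻ x in R, ∏ i, s i x ^ (p / P i) ≠ 0 :=
    fun R hR => setLIntegral_ne_zero_of_isCube
      (Finset.measurable_prod _ fun i _ => (hsm i).pow_const _) (by
        filter_upwards [ae_all_iff.2 hs0] with x hx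
        exact Finset.prod_ne_zero_iff.2 fun i _ =>
          (ENNReal.rpow_pos_of_nonneg (pos_iff_ne_zero.2 (hx i)) (hpPi i).le).ne') hR
  have hN : ∀ i, ∀ Q, IsCube Q → ∀ R, IsCube R → Q ⊆ R → ∀ x ∈ Q,
      (∫⁻ y in Q, s i y) / volume Q ≤ maximal (R.indicator (σ i)) x := by
    intro i Q hQ R _ hQR x hx
    rw [← hsQ]
    exact le_maximal_indicator (σ i) hQ hQR hx
  have hK : ∀ R, IsCube R → ∫⁻ x in R, ∏ i, maximal (R.indicator (σ i)) x ^ (p / P i) ≤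
      K * ∫⁻ x in R, ∏ i, s i x ^ (p / P i) := fun R hR =>
    (le_ratio_mul (hden R hR)).trans (mul_le_mul_left (hKle R hR) _)
  -- Guards against `∞ * 0 = 0` when `A = ∞`. On the unit cube `R` the numerator is positive, as
  -- `M(σ_i χ_R)` is at least the average of `σ_i` over `R`.
  have hK0 : K ≠ 0 := by
    have hR : IsCube (Set.univ.pi fun _ : Fin n => Set.Ico (0 : ℝ) (0 + 1)) :=
      ⟨fun _ => 0, 1, one_pos, rfl⟩
    set R := Set.univ.pi fun _ : Fin n => Set.Ico (0 : ℝ) (0 + 1)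
    intro h
    refine ratio_ne_zero ?_ (le_antisymm ((hKle R hR).trans h.le) zero_le)
    set b : ℝ≥0∞ := ∏ i, ((∫⁻ y in R, s i y) / volume R) ^ (p / P i)
    have hb : b ≠ 0 := Finset.prod_ne_zero_iff.2 fun i _ =>
      (ENNReal.rpow_pos_of_nonneg (ENNReal.div_pos
        (setLIntegral_ne_zero_of_isCube (hsm i) (hs0 i) hR) hR.volume_ne_top) (hpPi i).le).ne'
    have hle : b * volume R ≤ ∫⁻ x in R, ∏ i, maximal (R.indicator (σ i)) x ^ (p / P i) := by
      rw [← setLIntegral_const]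
      refine setLIntegral_mono' hR.measurableSet fun x hx => ?_
      exact Finset.prod_le_prod' fun i _ =>
        ENNReal.rpow_le_rpow (hN i R hR R hR subset_rfl x hx) (hpPi i).le
    exact ne_bot_of_le_ne_bot (mul_ne_zero hb hR.volume_ne_zero) hle
  -- domination by the dyadic maximal functions
  let L : Set (Fin n → ℝ) → ℝ≥0∞ := fun Q => ∏ i, (∫⁻ y in Q, F i y * s i y) / volume Q
  have hLm : ∀ α, Measurable (familySup (grid α) L) := fun α =>
    measurable_familySup (countable_grid α) (fun Q hQ => (isCube_of_mem_grid hQ).measurableSet) L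
  -- This holds at every point: averages do not see the change to measurable representatives. The
  -- right side is measurable, so measurability of `multiMaximal` is not needed.
  have hdom : ∀ x, multiMaximal (fun i x => f i x * (σ i x : ℂ)) x ^ p ≤
      ((6 ^ n) ^ m) ^ p * ((Fintype.card (Fin n → Fin 2) : ℝ≥0∞) ^ p *
        ∑ α, familySup (grid α) L x ^ p) := by
    intro x
    calc multiMaximal (fun i x => f i x * (σ i x : ℂ)) x ^ p
        ≤ ((6 ^ n) ^ m * ∑ α, familySup (grid α) L x) ^ p := by
          refine ENNReal.rpow_le_rpow (iSup₂_le fun Q hQ => iSup_le fun hx => ?_) hp0.le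
          have h := prod_average_le_sum_familySup (fun i y => F i y * s i y) hQ hx
          rw [Fintype.card_fin] at h
          refine le_trans (le_of_eq ?_) h
          refine Finset.prod_congr rfl fun i _ => ?_
          rw [setLAverage_eq, lintegral_congr_ae (ae_restrict_of_ae (hfs i))]
      _ ≤ _ := by
          rw [ENNReal.mul_rpow_of_nonneg _ _ hp0.le]
          gcongr 1
          exact sum_rpow_le_card_rpow_mul _ hp0.le
  set B := ∏ i, (∫⁻ x, F i x ^ P i * s i x) ^ (p / P i) with hBdef
  have hmain : ∫⁻ x, multiMaximal (fun i x => f i x * (σ i x : ℂ)) x ^ p ∂wMeasure v ≤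
      D * (A * K) * B := by
    calc _ ≤ ∫⁻ x, ((6 ^ n) ^ m) ^ p * ((Fintype.card (Fin n → Fin 2) : ℝ≥0∞) ^ p *
          ∑ α, familySup (grid α) L x ^ p) ∂wMeasure v := lintegral_mono hdom
      _ = ((6 ^ n) ^ m) ^ p * ((Fintype.card (Fin n → Fin 2) : ℝ≥0∞) ^ p *
          ∑ α, ∫⁻ x, familySup (grid α) L x ^ p ∂wMeasure v) := by
          rw [lintegral_const_mul _ ((Finset.measurable_sum _ fun α _ =>
              (hLm α).pow_const _).const_mul _),
            lintegral_const_mul _ (Finset.measurable_sum _ fun α _ => (hLm α).pow_const _),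
            lintegral_finsetSum _ fun α _ => (hLm α).pow_const _]
      _ ≤ ((6 ^ n) ^ m) ^ p * ((Fintype.card (Fin n → Fin 2) : ℝ≥0∞) ^ p *
          ∑ _α : Fin n → Fin 2, laminarConst p P * (A * K) * B) := by
          refine mul_le_mul' le_rfl (mul_le_mul' le_rfl (Finset.sum_le_sum fun α _ => ?_))
          rw [wMeasure, lintegral_withDensity_eq_lintegral_mul₀ hv.1.ennreal_ofReal
            ((hLm α).pow_const _).aemeasurable]
          refine le_trans (le_of_eq (lintegral_congr_ae ?_))
            (lintegral_familySup_grid_rpow_mul_le α hp0 hP hp hVm hsm hFm hs0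
              (fun i x => enorm_ne_top) hB hA hK0 hN hK)
          filter_upwards [hV] with x hx
          rw [Pi.mul_apply, hx, mul_comm]
      _ = D * (A * K) * B := by
          rw [Finset.sum_const, Finset.card_univ, nsmul_eq_mul, hD]; ring
  rw [eLpNorm_eq_lintegral_rpow_enorm_toReal (by simpa using hp0) (by simp),
    ENNReal.toReal_ofReal hp0.le]
  simp only [enorm_eq_self]
  calc _ ≤ (D * (A * K) * B) ^ (1 / p) := ENNReal.rpow_le_rpow hmain (by positivity)
    _ = D ^ (1 / p) * (A * K) ^ (1 / p) * B ^ (1 / p) := by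
        rw [ENNReal.mul_rpow_of_nonneg _ _ (by positivity),
          ENNReal.mul_rpow_of_nonneg _ _ (by positivity)]
    _ = _ := by
        congr 1
        rw [hBdef, ← ENNReal.prod_rpow_of_nonneg (by positivity)]
        refine Finset.prod_congr rfl fun i _ => ?_
        rw [hnorm i, ← ENNReal.rpow_mul]
        congr 1
        field_simp
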